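/- **Ness Uniqueness Theorem.** Let $(X,\omega,J)$ be a closed Kähler manifold (compact, without boundary, not necessarily connected), let $\mathrm{G}\subset\mathrm{U}(n)$ be a compact Lie group (a closed subgroup) with Lie algebra $\mathfrak{g}$, equipped with an invariant inner product, and let $\mathrm{G}$ act smoothly on $X$ by Kähler isometries, i.e. preserving $\omega$, $J$ and the metric $\langle\cdot,\cdot\rangle=\omega(\cdot,J\cdot)$. For $\xi\in\mathfrak{g}$ let $v_\xi(x)=\frac{d}{dt}\big|_{t=0}\exp(t\xi)x$. Let $\mu:X\to\mathfrak{g}$ be an equivariant moment map: for every $\xi\in\mathfrak g$ the function $H_\xi=\langle\mu,\xi\rangle$ is smooth and satisfies $\omega(v_\xi,\cdot)=dH_\xi$, and $\mu(ux)=u\mu(x)u^{-1}$ for $u\in\mathrm{G}$, $x\in X$. Let $\mathrm{G}^c=\{\exp(\mathbf{i}\eta)u \mid u\in\mathrm{G},\ \eta\in\mathfrak{g}\}\subset\mathrm{GL}(n,\mathbb{C})$ be the complexification of $\mathrm{G}$, acting on $X$ by the holomorphic extension of the action of $\mathrm{G}$; its infinitesimal action is $\xi+\mathbf{i}\eta\mapsto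 v_\xi+Jv_\eta$, so that $\exp(\mathbf{i}\eta)$ acts as the time-one map of the flow of the vector field $Jv_\eta$. If $x_0,x_1\in X$ are critical points of the function $f=\tfrac12|\mu|^2:X\to\mathbb{R}$ and $x_1\in\mathrm{G}^c(x_0)$, then $x_1\in\mathrm{G}(x_0)$. -/

import Mathlib

open scoped Manifold ContDiff Topology Matrix

/-! ### Compact matrix groups, their Lie algebras and their complexifications -/

namespace NessUniqueness

open NormedSpace Filter in
theorem norm_pow_sub_pow_le_of_norm_le {A : Type*} [NormedRing A] [NormOneClass A]
    {p q : A} {M : ℝ} (hM : 1 ≤ M) (hp : ‖p‖ ≤ M) (hq : ‖q‖ ≤ M) (k : ℕ) :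
    ‖p ^ k - q ^ k‖ ≤ k * M ^ k * ‖p - q‖ := by
  have hM0 : 0 ≤ M := zero_le_one.trans hM
  induction k with
  | zero => simp
  | succ k ih =>
    have e : p ^ (k + 1) - q ^ (k + 1) = p * (p ^ k - q ^ k) + (p - q) * q ^ k := by
      rw [pow_succ' p, pow_succ' q]; noncomm_ring
    have h1 : ‖p * (p ^ k - q ^ k)‖ ≤ M * (k * M ^ k * ‖p - q‖) :=
      (norm_mul_le _ _).trans (mul_le_mul hp ih (norm_nonneg _) hM0)
    have h2 : ‖(p - q) * q ^ k‖ ≤ ‖p - q‖ * M ^ k :=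
      (norm_mul_le _ _).trans (mul_le_mul_of_nonneg_left
        ((norm_pow_le _ _).trans (pow_le_pow_left₀ (norm_nonneg _) hq k)) (norm_nonneg _))
    have h3 : ‖p - q‖ * M ^ k ≤ ‖p - q‖ * M ^ (k + 1) :=
      mul_le_mul_of_nonneg_left (pow_le_pow_right₀ hM (Nat.le_succ k)) (norm_nonneg _)
    rw [e]
    refine (norm_add_le _ _).trans ?_
    push_cast
    calc _ ≤ M * (k * M ^ k * ‖p - q‖) + ‖p - q‖ * M ^ (k + 1) := add_le_add h1 (h2.trans h3)
      _ = _ := by ring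

open NormedSpace Filter in
theorem tendsto_pow_exp_of_hasDerivAt {A : Type*} [NormedRing A] [NormOneClass A]
    [NormedAlgebra ℝ A] [CompleteSpace A] {f : ℝ → A} {a : A} (hf0 : f 0 = 1)
    (hf : HasDerivAt f a 0) :
    Tendsto (fun k : ℕ => f ((k : ℝ)⁻¹) ^ k) atTop (𝓝 (exp a)) := by
  have hg : HasDerivAt (fun t : ℝ => exp (t • a)) a 0 := by
    simpa using hasDerivAt_exp_smul_const a (0 : ℝ)
  have hinv : Tendsto (fun k : ℕ => ((k : ℝ)⁻¹)) atTop (𝓝 0) := tendsto_inv_atTop_nhds_zero_nat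
  have bound : ∀ {g : ℝ → A}, g 0 = 1 → HasDerivAt g a 0 →
      ∀ᶠ k : ℕ in atTop, ‖g ((k : ℝ)⁻¹)‖ ≤ 1 + (‖a‖ + 1) * (k : ℝ)⁻¹ := by
    intro g g0 hg
    have h := (hg.isLittleO.bound (c := 1) one_pos)
    filter_upwards [hinv.eventually h] with k hk
    have hk0 : (0 : ℝ) ≤ (k : ℝ)⁻¹ := by positivity
    simp only [g0, sub_zero, Real.norm_eq_abs, abs_of_nonneg hk0, one_mul] at hk
    have : g ((k : ℝ)⁻¹) = 1 + (k : ℝ)⁻¹ • a + (g ((k : ℝ)⁻¹) - 1 - (k : ℝ)⁻¹ • a) := by abel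
    rw [this]
    refine (norm_add_le _ _).trans ((add_le_add (norm_add_le _ _) hk).trans ?_)
    rw [norm_one, norm_smul, Real.norm_eq_abs, abs_of_nonneg hk0]
    linarith
  have key : Tendsto (fun k : ℕ => f ((k : ℝ)⁻¹) ^ k - exp a) atTop (𝓝 0) := by
    have hd : HasDerivAt (fun t => f t - exp (t • a)) (a - a) 0 := hf.sub hg
    rw [Metric.tendsto_atTop']
    intro ε hε
    have hc : 0 < ε / (2 * Real.exp (‖a‖ + 1)) := by positivity
    have h := hinv.eventually (hd.isLittleO.bound hc)
    have hev := ((bound hf0 hf).and ((bound (by simp) hg).and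
      (h.and (eventually_ge_atTop 1))))
    obtain ⟨N, hN⟩ := eventually_atTop.1 hev
    refine ⟨N, fun k hk => ?_⟩
    obtain ⟨h1, h2, h3, h4⟩ := hN k hk.le
    have hkpos : (0 : ℝ) < k := by exact_mod_cast h4
    have hk0 : (0 : ℝ) ≤ (k : ℝ)⁻¹ := by positivity
    have hexp : exp a = exp ((k : ℝ)⁻¹ • a) ^ k := by
      let _ : NormedAlgebra ℚ A := NormedAlgebra.restrictScalars ℚ ℝ A
      rw [← exp_nsmul, ← Nat.cast_smul_eq_nsmul ℝ, smul_smul, mul_inv_cancel₀ hkpos.ne', one_smul]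
    have h5 := norm_pow_sub_pow_le_of_norm_le
      (M := 1 + (‖a‖ + 1) * (k : ℝ)⁻¹) (by nlinarith [norm_nonneg a]) h1 h2 k
    have h6 : (1 + (‖a‖ + 1) * (k : ℝ)⁻¹) ^ k ≤ Real.exp (‖a‖ + 1) := by
      have := Real.add_one_le_exp ((‖a‖ + 1) * (k : ℝ)⁻¹)
      calc _ ≤ Real.exp ((‖a‖ + 1) * (k : ℝ)⁻¹) ^ k :=
            pow_le_pow_left₀ (by positivity) (by linarith) k
        _ = _ := by rw [← Real.exp_nat_mul]; congr 1; field_simp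
    simp only [hf0, zero_smul, exp_zero, sub_self, sub_zero, smul_zero, Real.norm_eq_abs,
      abs_of_nonneg hk0] at h3
    rw [dist_zero_right, hexp]
    calc _ ≤ _ := h5
      _ ≤ k * Real.exp (‖a‖ + 1) * (ε / (2 * Real.exp (‖a‖ + 1)) * (k : ℝ)⁻¹) := by gcongr
      _ = ε / 2 := by field_simp
      _ < ε := by linarith
  simpa using key.add_const (exp a)

variable {n : ℕ}

/-- The matrices that lie in the closed subgroup `G` of `U(n)`. -/
def matrixSet (G : ClosedSubgroup (Matrix.unitaryGroup (Fin n) ℂ)) :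
    Set (Matrix (Fin n) (Fin n) ℂ) :=
  {g | ∃ u : G, ((u : Matrix.unitaryGroup (Fin n) ℂ) : Matrix (Fin n) (Fin n) ℂ) = g}

theorem isClosed_matrixSet (G : ClosedSubgroup (Matrix.unitaryGroup (Fin n) ℂ)) :
    IsClosed (matrixSet G) := by
  have h1 : IsClosed (Matrix.unitaryGroup (Fin n) ℂ : Set (Matrix (Fin n) (Fin n) ℂ)) :=
    isClosed_unitary
  have h2 := h1.isClosedEmbedding_subtypeVal.isClosedMap _ G.isClosed'
  convert h2 using 1
  ext g
  constructor
  · rintro ⟨u, rfl⟩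
    exact ⟨u.1, u.2, rfl⟩
  · rintro ⟨u, hu, rfl⟩
    exact ⟨⟨u, hu⟩, rfl⟩

theorem mul_mem_matrixSet (G : ClosedSubgroup (Matrix.unitaryGroup (Fin n) ℂ))
    {a b : Matrix (Fin n) (Fin n) ℂ} (ha : a ∈ matrixSet G) (hb : b ∈ matrixSet G) :
    a * b ∈ matrixSet G := by
  obtain ⟨u, rfl⟩ := ha
  obtain ⟨v, rfl⟩ := hb
  exact ⟨u * v, rfl⟩

theorem one_mem_matrixSet (G : ClosedSubgroup (Matrix.unitaryGroup (Fin n) ℂ)) :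
    (1 : Matrix (Fin n) (Fin n) ℂ) ∈ matrixSet G := ⟨1, rfl⟩

theorem pow_mem_matrixSet (G : ClosedSubgroup (Matrix.unitaryGroup (Fin n) ℂ))
    {a : Matrix (Fin n) (Fin n) ℂ} (ha : a ∈ matrixSet G) (k : ℕ) : a ^ k ∈ matrixSet G := by
  obtain ⟨u, rfl⟩ := ha
  exact ⟨u ^ k, rfl⟩

section
open scoped Matrix.Norms.Operator

theorem exp_add_mem_matrixSet (G : ClosedSubgroup (Matrix.unitaryGroup (Fin n) ℂ))
    {a b : Matrix (Fin n) (Fin n) ℂ}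
    (ha : ∀ t : ℝ, NormedSpace.exp (t • a) ∈ matrixSet G)
    (hb : ∀ t : ℝ, NormedSpace.exp (t • b) ∈ matrixSet G) :
    NormedSpace.exp (a + b) ∈ matrixSet G := by
  rcases n.eq_zero_or_pos with rfl | hn
  · rw [Subsingleton.elim (NormedSpace.exp (a + b)) 1]
    exact one_mem_matrixSet G
  · have : Nonempty (Fin n) := ⟨⟨0, hn⟩⟩
    have h1 := (hasDerivAt_exp_smul_const a (0 : ℝ)).mul (hasDerivAt_exp_smul_const b (0 : ℝ))
    simp only [zero_smul, NormedSpace.exp_zero, one_mul, mul_one] at h1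
    refine (isClosed_matrixSet G).mem_of_tendsto
      (tendsto_pow_exp_of_hasDerivAt (by simp) h1) (Filter.Eventually.of_forall fun k => ?_)
    exact pow_mem_matrixSet G (mul_mem_matrixSet G (ha _) (hb _)) k

end

/-- The Lie algebra `𝔤 = {ξ | exp (t ξ) ∈ G for all real t}` of the closed subgroup `G ⊆ U(n)`,
a real vector space of (skew-Hermitian) matrices. -/
def lieAlg (G : ClosedSubgroup (Matrix.unitaryGroup (Fin n) ℂ)) :
    Submodule ℝ (Matrix (Fin n) (Fin n) ℂ) where
  carrier := {ξ | ∀ t : ℝ, NormedSpace.exp (t • ξ) ∈ matrixSet G}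
  zero_mem' t := by simpa using one_mem_matrixSet G
  add_mem' {a b} ha hb t := by
    rw [smul_add]
    refine exp_add_mem_matrixSet G (fun s => ?_) (fun s => ?_)
    · rw [smul_smul]; exact ha _
    · rw [smul_smul]; exact hb _
  smul_mem' c a ha t := by rw [smul_smul]; exact ha _

theorem exp_mem_matrixSet {G : ClosedSubgroup (Matrix.unitaryGroup (Fin n) ℂ)}
    (ξ : lieAlg G) : NormedSpace.exp (ξ : Matrix (Fin n) (Fin n) ℂ) ∈ matrixSet G := by
  simpa using ξ.2 1

/-- The exponential map `exp : 𝔤 → G`. -/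
noncomputable def expG {G : ClosedSubgroup (Matrix.unitaryGroup (Fin n) ℂ)} (ξ : lieAlg G) : G :=
  ⟨⟨NormedSpace.exp (ξ : Matrix (Fin n) (Fin n) ℂ), by
      obtain ⟨u, hu⟩ := exp_mem_matrixSet ξ
      rw [← hu]; exact u.1.2⟩, by
      obtain ⟨u, hu⟩ := exp_mem_matrixSet ξ
      convert u.2
      exact hu.symm⟩

/-- The adjoint action `ξ ↦ u ξ u⁻¹` of `G` on its Lie algebra. -/
noncomputable def adj {G : ClosedSubgroup (Matrix.unitaryGroup (Fin n) ℂ)} (u : G) (ξ : lieAlg G) : lieAlg G :=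
  ⟨((u : Matrix.unitaryGroup (Fin n) ℂ) : Matrix (Fin n) (Fin n) ℂ) * ξ *
      ((u⁻¹ : G) : Matrix.unitaryGroup (Fin n) ℂ), by
    intro t
    have hu : IsUnit ((u : Matrix.unitaryGroup (Fin n) ℂ) : Matrix (Fin n) (Fin n) ℂ) :=
      (Unitary.toUnits (u : Matrix.unitaryGroup (Fin n) ℂ)).isUnit
    have hinv : ((((u⁻¹ : G) : Matrix.unitaryGroup (Fin n) ℂ)) : Matrix (Fin n) (Fin n) ℂ) =
        ((u : Matrix.unitaryGroup (Fin n) ℂ) : Matrix (Fin n) (Fin n) ℂ)⁻¹ := by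
      symm
      apply Matrix.inv_eq_right_inv
      exact congrArg (fun w : G => ((w : Matrix.unitaryGroup (Fin n) ℂ) :
        Matrix (Fin n) (Fin n) ℂ)) (mul_inv_cancel u)
    have e : t • (((u : Matrix.unitaryGroup (Fin n) ℂ) : Matrix (Fin n) (Fin n) ℂ) * ξ *
        ((u⁻¹ : G) : Matrix.unitaryGroup (Fin n) ℂ)) =
        ((u : Matrix.unitaryGroup (Fin n) ℂ) : Matrix (Fin n) (Fin n) ℂ) *
          (t • (ξ : Matrix (Fin n) (Fin n) ℂ)) *
          ((u : Matrix.unitaryGroup (Fin n) ℂ) : Matrix (Fin n) (Fin n) ℂ)⁻¹ := by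
      rw [hinv, mul_smul_comm, smul_mul_assoc]
    rw [e, Matrix.exp_conj _ _ hu, ← hinv]
    exact mul_mem_matrixSet G (mul_mem_matrixSet G ⟨u, rfl⟩ (ξ.2 t)) ⟨u⁻¹, rfl⟩⟩

/-- The complexification `Gᶜ = {exp (i η) u | u ∈ G, η ∈ 𝔤} ⊆ GL(n, ℂ)`. -/
def complexification (G : ClosedSubgroup (Matrix.unitaryGroup (Fin n) ℂ)) :
    Set (Matrix.GeneralLinearGroup (Fin n) ℂ) :=
  {g | ∃ (u : G) (η : lieAlg G), (g : Matrix (Fin n) (Fin n) ℂ) =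
    NormedSpace.exp (Complex.I • (η : Matrix (Fin n) (Fin n) ℂ)) *
      ((u : Matrix.unitaryGroup (Fin n) ℂ) : Matrix (Fin n) (Fin n) ℂ)}

/-- An invariant inner product on the Lie algebra `𝔤`. -/
structure InvariantInner (G : ClosedSubgroup (Matrix.unitaryGroup (Fin n) ℂ)) where
  /-- the underlying real bilinear form -/
  form : lieAlg G →ₗ[ℝ] lieAlg G →ₗ[ℝ] ℝ
  symm : ∀ ξ η, form ξ η = form η ξ
  pos : ∀ ξ, ξ ≠ 0 → 0 < form ξ ξ
  invariant : ∀ (u : G) (ξ η), form (adj u ξ) (adj u η) = form ξ η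

/-! ### Kähler manifolds

A complex manifold `X` is a space charted on a finite-dimensional complex vector space `E` with
holomorphic transition maps. Its underlying real manifold is described by the model `𝓘(ℝ, E)`. -/

section Kaehler

variable (E : Type*) [NormedAddCommGroup E] [NormedSpace ℂ E]
  (X : Type*) [TopologicalSpace X] [ChartedSpace E X]

variable {E X} in
/-- The complex structure `J : T_x X → T_x X`, that is, multiplication by `i`.
It does not depend on the chart that identifies `T_x X` with `E`, since the transition maps of `X`
are holomorphic. -/
noncomputable def cplxJ {x : X} (v : TangentSpace 𝓘(ℝ, E) x) : TangentSpace 𝓘(ℝ, E) x :=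
  ((fun w : E => Complex.I • w) v : E)

variable {E X} in
/-- The pullback of a two-form on `X` under the inverse of the chart around `c`: a two-form on the
vector space `E`, meaningful on the target of the chart. -/
noncomputable def inChart (Ω : ∀ x : X, (TangentSpace 𝓘(ℝ, E) x) [⋀^Fin 2]→L[ℝ] ℝ) (c : X) :
    E → E [⋀^Fin 2]→L[ℝ] ℝ := fun y =>
  (Ω ((chartAt E c).symm y)).compContinuousLinearMap
    (mfderiv 𝓘(ℝ, E) 𝓘(ℝ, E) (chartAt E c).symm y)

/-- A Kähler form on the complex manifold `X`: a smooth closed two-form `Ω` that is compatible with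
the complex structure, so that `⟨v, w⟩ = Ω(v, J w)` is a Riemannian metric (symmetry of the metric
is the `J`-invariance of `Ω`). Nondegeneracy of `Ω` follows from positivity. -/
structure KaehlerForm where
  /-- the two-form -/
  form : ∀ x : X, (TangentSpace 𝓘(ℝ, E) x) [⋀^Fin 2]→L[ℝ] ℝ
  smooth : ∀ c : X, ContDiffOn ℝ ∞ (inChart form c) (chartAt E c).target
  closed : ∀ c : X, ∀ y ∈ (chartAt E c).target, extDeriv (inChart form c) y = 0
  invariant : ∀ (x : X) (v w : TangentSpace 𝓘(ℝ, E) x),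
    form x ![cplxJ v, cplxJ w] = form x ![v, w]
  pos : ∀ (x : X) (v : TangentSpace 𝓘(ℝ, E) x), v ≠ 0 → 0 < form x ![v, cplxJ v]

end Kaehler

/-! ### Hamiltonian actions and the moment map squared -/

section Action

variable {E : Type*} [NormedAddCommGroup E] [NormedSpace ℂ E]
  {X : Type*} [TopologicalSpace X] [ChartedSpace E X]
  {G : ClosedSubgroup (Matrix.unitaryGroup (Fin n) ℂ)} [MulAction G X]

/-- A smooth action of the Lie group `G` on `X` by Kähler isometries. -/
structure IsKaehlerAction (G : ClosedSubgroup (Matrix.unitaryGroup (Fin n) ℂ)) [MulAction G X]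
    (Ω : KaehlerForm E X) : Prop where
  /-- The map `G × X → X` is smooth. Near `u : G` it is written in the exponential coordinates
  `s ↦ exp (∑ i, s i • ξ i) * u`, which parametrize a neighbourhood of `u` in `G` when `ξ` is a
  basis of `𝔤`. -/
  smooth : ∀ (k : ℕ) (ξ : Fin k → lieAlg G) (u : G),
    ContMDiff (𝓘(ℝ, Fin k → ℝ).prod 𝓘(ℝ, E)) 𝓘(ℝ, E) ∞
      (fun p : (Fin k → ℝ) × X => (expG (∑ i, p.1 i • ξ i) * u) • p.2)
  /-- `G` preserves the complex structure. -/
  holomorphic : ∀ u : G, MDifferentiable 𝓘(ℂ, E) 𝓘(ℂ, E) (fun x : X => u • x)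
  /-- `G` preserves the Kähler form. -/
  symplectic : ∀ (u : G) (x : X) (v w : TangentSpace 𝓘(ℝ, E) x),
    Ω.form (u • x) ![mfderiv 𝓘(ℝ, E) 𝓘(ℝ, E) (fun y : X => u • y) x v,
      mfderiv 𝓘(ℝ, E) 𝓘(ℝ, E) (fun y : X => u • y) x w] = Ω.form x ![v, w]

/-- The infinitesimal action: `v_ξ(x)` is the velocity of the curve `t ↦ exp (t ξ) x` at `t = 0`. -/
noncomputable def infAction (E : Type*) [NormedAddCommGroup E] [NormedSpace ℂ E]
    {X : Type*} [TopologicalSpace X] [ChartedSpace E X]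
    {G : ClosedSubgroup (Matrix.unitaryGroup (Fin n) ℂ)} [MulAction G X]
    (ξ : lieAlg G) (x : X) : TangentSpace 𝓘(ℝ, E) x :=
  (mfderiv 𝓘(ℝ, ℝ) 𝓘(ℝ, E) (fun t : ℝ => expG (t • ξ) • x) 0 (1 : ℝ) : E)

/-- `μ : X → 𝔤` is an equivariant moment map for the action: `v_ξ` is the Hamiltonian vector field
of `H_ξ = ⟨μ, ξ⟩`, in the sense that `Ω(v_ξ, ·) = dH_ξ`, and `μ(u x) = u μ(x) u⁻¹`. -/
structure IsMomentMap (Ω : KaehlerForm E X) (B : InvariantInner G) (μ : X → lieAlg G) : Prop where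
  smooth : ∀ ξ : lieAlg G, ContMDiff 𝓘(ℝ, E) 𝓘(ℝ, ℝ) ∞ (fun x => B.form (μ x) ξ)
  hamiltonian : ∀ (ξ : lieAlg G) (x : X) (v : TangentSpace 𝓘(ℝ, E) x),
    mfderiv 𝓘(ℝ, E) 𝓘(ℝ, ℝ) (fun y => B.form (μ y) ξ) x v = Ω.form x ![infAction E ξ x, v]
  equivariant : ∀ (u : G) (x : X), μ (u • x) = adj u (μ x)

/-- The function `f = ½ |μ|²`. -/
noncomputable def momentSq (B : InvariantInner G) (μ : X → lieAlg G) (x : X) : ℝ :=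
  1 / 2 * B.form (μ x) (μ x)

/-- `x` is a critical point of `f = ½ |μ|²`. -/
def IsCritical (E : Type*) [NormedAddCommGroup E] [NormedSpace ℂ E]
    {X : Type*} [TopologicalSpace X] [ChartedSpace E X]
    {G : ClosedSubgroup (Matrix.unitaryGroup (Fin n) ℂ)}
    (B : InvariantInner G) (μ : X → lieAlg G) (x : X) : Prop :=
  mfderiv 𝓘(ℝ, E) 𝓘(ℝ, ℝ) (momentSq B μ) x = 0

/-- The graph of the action of `Gᶜ` on `X`: `ActsTo E G g x y` says that `g x = y`.
The holomorphic action of `Gᶜ` that extends the action of `G` has infinitesimal action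
`ξ + i η ↦ v_ξ + J v_η`, so the curve `t ↦ exp (i t η) z` is the integral curve through `z` of the
vector field `J v_η`. Hence `(exp (i η) u) x` is the value at time one of the integral curve of
`J v_η` that starts at `u x`. By polar decomposition `u` and `η` are determined by `g`. -/
def ActsTo (E : Type*) [NormedAddCommGroup E] [NormedSpace ℂ E]
    {X : Type*} [TopologicalSpace X] [ChartedSpace E X]
    (G : ClosedSubgroup (Matrix.unitaryGroup (Fin n) ℂ)) [MulAction G X]
    (g : Matrix.GeneralLinearGroup (Fin n) ℂ) (x y : X) : Prop :=
  ∃ (u : G) (η : lieAlg G), (g : Matrix (Fin n) (Fin n) ℂ) =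
      NormedSpace.exp (Complex.I • (η : Matrix (Fin n) (Fin n) ℂ)) *
        ((u : Matrix.unitaryGroup (Fin n) ℂ) : Matrix (Fin n) (Fin n) ℂ) ∧
    ∃ γ : ℝ → X, IsMIntegralCurve (I := 𝓘(ℝ, E)) γ (fun z => cplxJ (infAction E η z)) ∧
      γ 0 = u • x ∧ γ 1 = y

/-- The orbit `Gᶜ(x)`. -/
def complexOrbit (E : Type*) [NormedAddCommGroup E] [NormedSpace ℂ E]
    {X : Type*} [TopologicalSpace X] [ChartedSpace E X]
    (G : ClosedSubgroup (Matrix.unitaryGroup (Fin n) ℂ)) [MulAction G X] (x : X) : Set X :=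
  {y | ∃ g ∈ complexification G, ActsTo E G g x y}

end Action

end NessUniqueness

/-! Among all pairs (η, y) with y ∈ G(x₀) and x₁ = exp(iη)y, choose one with |η| minimal. It exists
because G(x₀) is compact and the time-one map (η, y) ↦ exp(iη)y is continuous. At a critical point
x, differentiating f in the direction J v_{μ(x)} gives v_{μ(x)}(x) = 0, and equivariance carries
this equation from x₀ to y.

Along the integral curve of J v_η from y to x₁ the function ⟨μ, η⟩ has derivative |v_η|² ≥ 0. If
⟨μ(x₁), η⟩ ≤ ⟨μ(y), η⟩, the curve is therefore constant and x₁ = y (`IsMomentMap.eq_of_form_le`).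

Otherwise the pair can be shortened (`exists_shorter`). The element iμ(y) of 𝔤ᶜ kills y, so its
conjugate by exp(iη) kills x₁, as does iμ(x₁). Let w be the difference. Since ad η is skew and
annihilates η, ⟨Im w, η⟩ = ⟨μ(y), η⟩ − ⟨μ(x₁), η⟩ < 0. Polar decomposition exp(tw) exp(iη) =
exp(iη_t) u_t gives x₁ = exp(iη_t) u_t y, while the derivative of |η_t|² at t = 0 is 2⟨Im w, η⟩ < 0.
This contradicts minimality.

The group law of Gᶜ is replaced by calculus with vector fields. The fields v_a + J v_b form a linear
family over 𝔤 ⊕ i𝔤 whose commutators are given by the complexified bracket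
(`fderiv_localField_cplxInfAct_comm`). Conjugation and the differential of exp become the first
variation of the time-one maps (`IsFlow.hasVelocity_time_one`), and the moving polar decomposition
becomes an ODE whose solvability is a linear boundary-value problem (`eq_zero_of_boundary`,
`exists_polar_curve`). -/

namespace NessUniqueness

open Set Metric Asymptotics Filter
open scoped NNReal

/-! ### Linear families of vector fields on a normed space -/

section NormedSpaceFlow

variable {E W : Type*} [NormedAddCommGroup E] [NormedSpace ℝ E]
  [NormedAddCommGroup W] [NormedSpace ℝ W]

theorem norm_le_mul_exp_of_norm_deriv_le {f f' : ℝ → E} {K δ ε : ℝ} (hK : 0 ≤ K) (hε : 0 ≤ ε)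
    (hf : ∀ s ∈ Icc (0 : ℝ) 1, HasDerivAt f (f' s) s) (h0 : ‖f 0‖ ≤ δ)
    (hb : ∀ s ∈ Icc (0 : ℝ) 1, ‖f' s‖ ≤ K * ‖f s‖ + ε) :
    ∀ s ∈ Icc (0 : ℝ) 1, ‖f s‖ ≤ (δ + ε) * Real.exp (K + 1) := by
  intro s hs
  have hδ : 0 ≤ δ := (norm_nonneg _).trans h0
  -- The rate `K + 1` is nonzero even when `K = 0`, so a single branch of the Grönwall bound
  -- suffices.
  have h := norm_le_gronwallBound_of_norm_deriv_right_le (f := f) (f' := f') (δ := δ) (K := K + 1)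
    (ε := ε) (a := 0) (b := 1) (fun t ht => (hf t ht).continuousAt.continuousWithinAt)
    (fun t ht => (hf t (Ico_subset_Icc_self ht)).hasDerivWithinAt) h0
    (fun t ht => (hb t (Ico_subset_Icc_self ht)).trans (by nlinarith [norm_nonneg (f t)])) s hs
  refine h.trans ?_
  rw [gronwallBound_of_K_ne_0 (by positivity), sub_zero]
  have h1 : Real.exp ((K + 1) * s) ≤ Real.exp (K + 1) :=
    Real.exp_le_exp.2 (by nlinarith [hs.2, hs.1])
  have h2 : ε / (K + 1) ≤ ε := div_le_self hε (by linarith)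
  have h3 : 0 ≤ Real.exp ((K + 1) * s) - 1 := by
    have := Real.add_one_le_exp ((K + 1) * s)
    nlinarith [hs.1]
  have h4 : ε / (K + 1) * (Real.exp ((K + 1) * s) - 1) ≤ ε * Real.exp (K + 1) :=
    mul_le_mul h2 (by linarith) h3 hε
  have h5 : δ * Real.exp ((K + 1) * s) ≤ δ * Real.exp (K + 1) :=
    mul_le_mul_of_nonneg_left h1 hδ
  linarith

theorem exists_hasDerivAt_Ioo_of_lipschitzWith [CompleteSpace E] {v : E → E} {K M : ℝ≥0}
    (hK : LipschitzWith K v) (hM : ∀ y, ‖v y‖ ≤ M) (T : ℝ) (hT : 0 < T) (y : E) :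
    ∃ α : ℝ → E, α 0 = y ∧ ∀ t ∈ Ioo (-T) T, HasDerivAt α (v (α t)) t := by
  have h0 : (0 : ℝ) ∈ Icc (-T) T := ⟨by linarith, hT.le⟩
  have hpl : IsPicardLindelof (fun _ => v) (tmin := -T) (tmax := T) ⟨0, h0⟩ y
      (M * T.toNNReal) 0 M K :=
    IsPicardLindelof.of_time_independent (fun x _ => hM x) hK.lipschitzOnWith (by
      simp [hT.le])
  obtain ⟨α, h1, h2⟩ := hpl.exists_eq_forall_mem_Icc_hasDerivWithinAt₀
  exact ⟨α, h1, fun t ht => (h2 t (Ioo_subset_Icc_self ht)).hasDerivAt (Icc_mem_nhds ht.1 ht.2)⟩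

/-- Grönwall's inequality: the two velocities differ by a Lipschitz term in the position plus an
error from the parameters, bounded by `M * ‖ζ - ζ'‖`. This yields joint continuity of the time-one
map. -/
theorem dist_le_of_linear_family {g : E → W →L[ℝ] E} {K M : ℝ≥0} (hK : LipschitzWith K g)
    (hM : ∀ y, ‖g y‖ ≤ M) {ζ ζ' : W} {α β : ℝ → E}
    (hα : ∀ s ∈ Icc (0 : ℝ) 1, HasDerivAt α (g (α s) ζ) s)
    (hβ : ∀ s ∈ Icc (0 : ℝ) 1, HasDerivAt β (g (β s) ζ') s) :
    ∀ s ∈ Icc (0 : ℝ) 1,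
      ‖α s - β s‖ ≤ (‖α 0 - β 0‖ + M * ‖ζ - ζ'‖) * Real.exp (K * ‖ζ‖ + 1) := by
  refine norm_le_mul_exp_of_norm_deriv_le (f := fun s => α s - β s) (by positivity)
    (by positivity) (fun s hs => (hα s hs).sub (hβ s hs)) le_rfl (fun s _ => ?_)
  have e : g (α s) ζ - g (β s) ζ' = (g (α s) - g (β s)) ζ + g (β s) (ζ - ζ') := by
    simp
  rw [e]
  refine (norm_add_le _ _).trans (add_le_add ?_ ?_)
  · refine ((g (α s) - g (β s)).le_opNorm ζ).trans ?_
    have := hK.norm_sub_le (α s) (β s)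
    calc _ ≤ K * ‖α s - β s‖ * ‖ζ‖ := by gcongr
      _ = _ := by ring
  · exact ((g (β s)).le_opNorm _).trans (by gcongr; exact hM _)

theorem norm_sub_sub_le_of_lipschitzWith_fderiv {F : Type*} [NormedAddCommGroup F]
    [NormedSpace ℝ F] {g : E → F} {g' : E → E →L[ℝ] F} {C : ℝ≥0}
    (hg : ∀ y, HasFDerivAt g (g' y) y) (hC : LipschitzWith C g') (y w : E) :
    ‖g (y + w) - g y - g' y w‖ ≤ C * ‖w‖ * ‖w‖ := by
  have := (convex_closedBall y ‖w‖).norm_image_sub_le_of_norm_hasFDerivWithin_le'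
    (f := g) (f' := g') (φ := g' y) (C := C * ‖w‖) (x := y) (y := y + w)
    (fun x _ => (hg x).hasFDerivWithinAt) (fun x hx => ?_)
    (mem_closedBall_self (norm_nonneg _)) (by simp)
  · simpa using this
  · refine (hC.norm_sub_le x y).trans ?_
    gcongr
    simpa [dist_eq_norm] using hx

/-- The first variation of the time-one map of a linear family of vector fields. -/
theorem hasDerivAt_time_one {g : E → W →L[ℝ] E} {g' : E → E →L[ℝ] W →L[ℝ] E} {K M C : ℝ≥0}
    (hg : ∀ y, HasFDerivAt g (g' y) y) (hK : LipschitzWith K g) (hC : LipschitzWith C g')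
    (hM : ∀ y, ‖g y‖ ≤ M) {ζ : ℝ → W} {w : W} {t : ℝ} (hζ : HasDerivAt ζ w t)
    {α : ℝ → ℝ → E} (hα : ∀ᶠ τ in 𝓝 t, ∀ s ∈ Icc (0 : ℝ) 1, HasDerivAt (α τ) (g (α τ s) (ζ τ)) s)
    {br : W → W} {κ : ℝ → W} (hκ : ∀ s, HasDerivAt κ (br (κ s) + w) s)
    (hbr : ∀ s ∈ Icc (0 : ℝ) 1, g' (α t s) (g (α t s) (ζ t)) (κ s) + g (α t s) (br (κ s)) =
      g' (α t s) (g (α t s) (κ s)) (ζ t))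
    (h0 : HasDerivAt (fun τ => α τ 0) (g (α t 0) (κ 0)) t) :
    HasDerivAt (fun τ => α τ 1) (g (α t 1) (κ 1)) t := by
  have hαt := hα.self_of_nhds
  obtain ⟨N, hN⟩ : ∃ N : ℝ, ∀ s ∈ Icc (0 : ℝ) 1, ‖g (α t s) (κ s)‖ ≤ N := by
    obtain ⟨N, hN⟩ := isCompact_Icc.exists_bound_of_continuousOn (f := κ) (s := Icc (0 : ℝ) 1)
      (fun s _ => (hκ s).continuousAt.continuousWithinAt)
    refine ⟨M * N, fun s hs => ((g _).le_opNorm _).trans ?_⟩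
    exact mul_le_mul (hM _) (hN s hs) (norm_nonneg _) M.2
  have hN0 : 0 ≤ N := (norm_nonneg _).trans (hN 0 (by simp))
  -- The candidate variation along `α t` is `g (α t s) (κ s)`. Here `ρ` is the error of the linear
  -- approximation at `s = 0`, and `σ` bounds the inhomogeneous part of its growth; both are o(τ −
  -- t), so Grönwall finishes the proof.
  set ρ : ℝ → ℝ := fun τ => ‖α τ 0 - α t 0 - (τ - t) • g (α t 0) (κ 0)‖ with hρ
  set σ : ℝ → ℝ := fun τ => C * ‖ζ t‖ * (N * N) * (τ - t) ^ 2 + M * ‖ζ τ - ζ t - (τ - t) • w‖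
    + K * N * (|τ - t| * ‖ζ τ - ζ t‖) with hσ
  have hζc : Tendsto (fun τ => ζ τ - ζ t) (𝓝 t) (𝓝 0) := by
    have := hζ.continuousAt.tendsto.sub_const (ζ t)
    simpa using this
  have hid : Tendsto (fun τ => τ - t) (𝓝 t) (𝓝 0) := by
    have : Tendsto (fun τ : ℝ => τ - t) (𝓝 t) (𝓝 (t - t)) := (continuous_sub_right t).tendsto t
    simpa using this
  have hρo : ρ =o[𝓝 t] fun τ => τ - t := by
    have := h0.isLittleO
    exact this.norm_left
  have hσo : σ =o[𝓝 t] fun τ => τ - t := by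
    refine ((IsLittleO.const_mul_left ?_ _).add (IsLittleO.const_mul_left
      hζ.isLittleO.norm_left _)).add (IsLittleO.const_mul_left ?_ _)
    · simp only [pow_two]
      have h1 : (fun τ => τ - t) =o[𝓝 t] fun _ => (1 : ℝ) :=
        (isLittleO_one_iff ℝ).2 hid
      simpa using h1.mul_isBigO (isBigO_refl (fun τ => τ - t) (𝓝 t))
    · have h1 : (fun τ => ‖ζ τ - ζ t‖) =o[𝓝 t] fun _ => (1 : ℝ) :=
        ((isLittleO_one_iff ℝ).2 hζc).norm_left
      have h2 : (fun τ => |τ - t|) =O[𝓝 t] fun τ => τ - t :=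
        (isBigO_refl (fun τ => τ - t) (𝓝 t)).norm_left
      simpa using h2.mul_isLittleO h1
  obtain ⟨R, hR⟩ : ∃ R : ℝ, ∀ᶠ τ in 𝓝 t, ‖ζ τ‖ ≤ R :=
    ⟨‖ζ t‖ + 1, (hζ.continuousAt.norm.eventually (gt_mem_nhds (lt_add_one _))).mono
      fun _ h => h.le⟩
  have hR0 : 0 ≤ R := (norm_nonneg _).trans hR.self_of_nhds
  rw [hasDerivAt_iff_isLittleO]
  refine IsBigO.trans_isLittleO (g := fun τ => ρ τ + σ τ) ?_ (hρo.add hσo)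
  refine IsBigO.of_bound (Real.exp (K * R + 1)) ?_
  filter_upwards [hα, hR] with τ hατ hRτ
  have hσ0 : 0 ≤ σ τ := by positivity
  have key := norm_le_mul_exp_of_norm_deriv_le
    (f := fun s => α τ s - α t s - (τ - t) • g (α t s) (κ s))
    (f' := fun s => g (α τ s) (ζ τ) - g (α t s) (ζ t) - (τ - t) •
      (g' (α t s) (g (α t s) (ζ t)) (κ s) + g (α t s) (br (κ s) + w)))
    (K := K * R) (δ := ρ τ) (ε := σ τ) (by positivity) hσ0 (fun s hs => ?_) le_rfl
    (fun s hs => ?_) 1 (by simp)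
  · rw [Real.norm_of_nonneg (add_nonneg (norm_nonneg _) hσ0), mul_comm]
    exact key
  · have h1 : HasDerivAt (fun s => g (α t s)) (g' (α t s) (g (α t s) (ζ t))) s :=
      (hg (α t s)).comp_hasDerivAt s (hαt s hs)
    exact ((hατ s hs).sub (hαt s hs)).sub ((h1.clm_apply (hκ s)).const_smul (τ - t))
  · set h := τ - t
    set a := α t s
    set u := g a (κ s)
    -- By `hbr`, the candidate satisfies the linearised equation with right-hand side `g' a (g a (κ
    -- s)) (ζ t) + g a w`. The remainder splits into a Lipschitz term in the error itself, the
    -- Taylor remainder of `g`, that of `ζ`, and a mixed product.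
    have e : g (α τ s) (ζ τ) - g a (ζ t) - h • (g' a (g a (ζ t)) (κ s) + g a (br (κ s) + w)) =
        (g (α τ s) - g (a + h • u)) (ζ τ) + (g (a + h • u) - g a - g' a (h • u)) (ζ t)
          + g a (ζ τ - ζ t - h • w) + (g (a + h • u) - g a) (ζ τ - ζ t) := by
      rw [map_add, ← add_assoc, hbr s hs]
      simp only [map_sub, map_smul, sub_apply, smul_apply,
        smul_add]
      abel
    have hu : ‖u‖ ≤ N := hN s hs
    have hhu : ‖h • u‖ ≤ |h| * N := by
      rw [norm_smul, Real.norm_eq_abs]; gcongr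
    have b1 : ‖(g (α τ s) - g (a + h • u)) (ζ τ)‖ ≤ K * R * ‖α τ s - a - h • u‖ := by
      refine (ContinuousLinearMap.le_opNorm _ _).trans ?_
      have := hK.norm_sub_le (α τ s) (a + h • u)
      rw [← sub_sub] at this
      calc _ ≤ K * ‖α τ s - a - h • u‖ * R := by gcongr
        _ = _ := by ring
    have b2 : ‖(g (a + h • u) - g a - g' a (h • u)) (ζ t)‖ ≤ C * ‖ζ t‖ * (N * N) * h ^ 2 := by
      refine (ContinuousLinearMap.le_opNorm _ _).trans ?_
      have := norm_sub_sub_le_of_lipschitzWith_fderiv hg hC a (h • u)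
      calc _ ≤ C * ‖h • u‖ * ‖h • u‖ * ‖ζ t‖ := by gcongr
        _ ≤ C * (|h| * N) * (|h| * N) * ‖ζ t‖ := by gcongr
        _ = C * ‖ζ t‖ * (N * N) * |h| ^ 2 := by ring
        _ = _ := by rw [sq_abs]
    have b3 : ‖g a (ζ τ - ζ t - h • w)‖ ≤ M * ‖ζ τ - ζ t - h • w‖ :=
      ((g a).le_opNorm _).trans (by gcongr; exact hM _)
    have b4 : ‖(g (a + h • u) - g a) (ζ τ - ζ t)‖ ≤ K * N * (|h| * ‖ζ τ - ζ t‖) := by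
      refine (ContinuousLinearMap.le_opNorm _ _).trans ?_
      have := hK.norm_sub_le (a + h • u) a
      rw [add_sub_cancel_left] at this
      calc _ ≤ K * (|h| * N) * ‖ζ τ - ζ t‖ := by gcongr; exact this.trans (by gcongr)
        _ = _ := by ring
    rw [e]
    refine (norm_add_le _ _).trans ((add_le_add ((norm_add_le _ _).trans (add_le_add
      ((norm_add_le _ _).trans (add_le_add b1 b2)) b3)) b4).trans ?_)
    rw [hσ]
    simp only [add_assoc, le_refl, h]

end NormedSpaceFlow

/-! ### Velocities of curves in charts -/

section Velocity

variable {E : Type*} [NormedAddCommGroup E] [NormedSpace ℝ E]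
  {X : Type*} [TopologicalSpace X] [ChartedSpace E X]

/-- The coordinate change from the chart around `c` to the chart around `c'`. -/
def coordChange (E : Type*) [NormedAddCommGroup E] {X : Type*} [TopologicalSpace X]
    [ChartedSpace E X] (c c' : X) : E → E := fun y => chartAt E c' ((chartAt E c).symm y)

/-- The derivative at `x` of the chart around `c`, where `T_x X` is identified with `E` by means
of the preferred chart around `x`. -/
noncomputable def chartDeriv (c x : X) : E →L[ℝ] E :=
  fderiv ℝ (coordChange E x c) (chartAt E x x)

/-- The curve `γ` in `X` has velocity `v` at time `t`. -/
def HasVelocity (γ : ℝ → X) (v : E) (t : ℝ) : Prop :=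
  ContinuousAt γ t ∧ HasDerivAt (fun τ => chartAt E (γ t) (γ τ)) v t

/-- This is the bridge between concrete chart computations and the theory of integral curves on
manifolds. -/
theorem hasVelocity_iff_hasMFDerivAt {γ : ℝ → X} {v : E} {t : ℝ} :
    HasVelocity γ v t ↔
      HasMFDerivAt 𝓘(ℝ, ℝ) 𝓘(ℝ, E) γ t ((1 : ℝ →L[ℝ] ℝ).smulRight v : ℝ →L[ℝ] E) := by
  unfold HasVelocity HasMFDerivAt
  refine and_congr_right fun _ => ?_
  have e : ((1 : ℝ →L[ℝ] ℝ).smulRight v : ℝ →L[ℝ] E) = ContinuousLinearMap.toSpanSingleton ℝ v := by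
    ext; simp
  rw [hasDerivAt_iff_hasFDerivAt, e, ← hasFDerivWithinAt_univ]
  simp only [mfld_simps]
  rfl

theorem HasVelocity.congr_of_eventuallyEq {γ γ' : ℝ → X} {v : E} {t : ℝ}
    (h : HasVelocity γ v t) (he : γ' =ᶠ[𝓝 t] γ) : HasVelocity γ' v t := by
  refine ⟨h.1.congr_of_eventuallyEq he, ?_⟩
  rw [he.self_of_nhds]
  exact h.2.congr_of_eventuallyEq (he.mono fun τ hτ => by simp [hτ])

theorem HasVelocity.comp {γ : ℝ → X} {v : E} {f : ℝ → ℝ} {a t : ℝ} (h : HasVelocity γ v (f t))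
    (hf : HasDerivAt f a t) : HasVelocity (fun τ => γ (f τ)) (a • v) t :=
  ⟨ContinuousAt.comp (f := f) h.1 hf.continuousAt, h.2.scomp t hf⟩

theorem hasVelocity_const (x : X) (t : ℝ) : HasVelocity (fun _ => x) (0 : E) t :=
  ⟨continuousAt_const, hasDerivAt_const _ _⟩

theorem HasVelocity.unique {γ : ℝ → X} {v w : E} {t : ℝ} (h : HasVelocity γ v t)
    (h' : HasVelocity γ w t) : v = w := h.2.unique h'.2

theorem chartDeriv_self (x : X) : chartDeriv x x = ContinuousLinearMap.id ℝ E := by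
  have : coordChange E x x =ᶠ[𝓝 (chartAt E x x)] id := by
    filter_upwards [(chartAt E x).open_target.mem_nhds (mem_chart_target E x)] with y hy
    exact (chartAt E x).right_inv hy
  rw [chartDeriv, this.fderiv_eq, fderiv_id]

variable [IsManifold 𝓘(ℝ, E) ∞ X]

theorem contDiffAt_coordChange {c c' : X} {y : E} (hy : y ∈ (chartAt E c).target)
    (hy' : (chartAt E c).symm y ∈ (chartAt E c').source) :
    ContDiffAt ℝ ∞ (coordChange E c c') y := by
  have h := contDiffOn_ext_coord_change (I := 𝓘(ℝ, E)) (n := ∞) c' c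
  have hs : ((extChartAt 𝓘(ℝ, E) c).symm ≫ extChartAt 𝓘(ℝ, E) c').source ∈ 𝓝 y := by
    simp only [mfld_simps]
    exact ((chartAt E c).isOpen_inter_preimage_symm (chartAt E c').open_source).mem_nhds
      ⟨hy, hy'⟩
  have := h.contDiffAt hs
  simpa only [mfld_simps] using! this

theorem hasFDerivAt_coordChange {c c' x : X} (hc : x ∈ (chartAt E c).source)
    (hc' : x ∈ (chartAt E c').source) :
    HasFDerivAt (coordChange E c c') (fderiv ℝ (coordChange E c c') (chartAt E c x))
      (chartAt E c x) := by
  refine ((contDiffAt_coordChange ((chartAt E c).map_source hc) ?_).differentiableAt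
    (by simp)).hasFDerivAt
  rwa [(chartAt E c).left_inv hc]

/-- Chain rule for the cocycle identity of coordinate changes, starting from the preferred chart at
`x`. -/
theorem fderiv_coordChange_comp_chartDeriv {c c' x : X} (hc : x ∈ (chartAt E c).source)
    (hc' : x ∈ (chartAt E c').source) :
    (fderiv ℝ (coordChange E c c') (chartAt E c x)).comp (chartDeriv c x) = chartDeriv c' x := by
  have h1 := hasFDerivAt_coordChange (c := x) (c' := c) (mem_chart_source E x) hc
  have h2 := hasFDerivAt_coordChange hc hc'
  have e : coordChange E x c (chartAt E x x) = chartAt E c x := by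
    simp [coordChange, (chartAt E x).left_inv (mem_chart_source E x)]
  have h3 := HasFDerivAt.comp (chartAt E x x) (by rw [e]; exact h2) h1
  refine (HasFDerivAt.fderiv (h3.congr_of_eventuallyEq ?_)).symm
  have h4 := (chartAt E x).isOpen_inter_preimage_symm (chartAt E c).open_source
  filter_upwards [h4.mem_nhds ⟨mem_chart_target E x, by
    simpa [(chartAt E x).left_inv (mem_chart_source E x)] using hc⟩] with y hy
  simp [coordChange, (chartAt E c).left_inv hy.2]

theorem fderiv_coordChange_chartDeriv {c x : X} (hc : x ∈ (chartAt E c).source) (v : E) :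
    fderiv ℝ (coordChange E c x) (chartAt E c x) (chartDeriv c x v) = v := by
  have := congrArg (fun L : E →L[ℝ] E => L v)
    (fderiv_coordChange_comp_chartDeriv hc (mem_chart_source E x))
  simpa [chartDeriv_self] using this

theorem HasVelocity.hasDerivAt {γ : ℝ → X} {v : E} {t : ℝ} (h : HasVelocity γ v t) {c : X}
    (hc : γ t ∈ (chartAt E c).source) :
    HasDerivAt (fun τ => chartAt E c (γ τ)) (chartDeriv c (γ t) v) t := by
  have h1 := hasFDerivAt_coordChange (c := γ t) (c' := c) (mem_chart_source E (γ t)) hc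
  refine (h1.comp_hasDerivAt t h.2).congr_of_eventuallyEq ?_
  filter_upwards [h.1.eventually ((chartAt E (γ t)).open_source.mem_nhds
    (mem_chart_source E (γ t)))] with τ hτ
  simp [coordChange, (chartAt E (γ t)).left_inv hτ]

theorem hasVelocity_of_hasDerivAt {γ : ℝ → X} {v : E} {t : ℝ} (hγ : ContinuousAt γ t) {c : X}
    (hc : γ t ∈ (chartAt E c).source)
    (h : HasDerivAt (fun τ => chartAt E c (γ τ)) (chartDeriv c (γ t) v) t) :
    HasVelocity γ v t := by
  refine ⟨hγ, ?_⟩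
  have h1 := hasFDerivAt_coordChange (c' := γ t) hc (mem_chart_source E (γ t))
  have h2 := h1.comp_hasDerivAt t h
  rw [fderiv_coordChange_chartDeriv hc] at h2
  refine h2.congr_of_eventuallyEq ?_
  filter_upwards [hγ.eventually ((chartAt E c).open_source.mem_nhds hc)] with τ hτ
  simp [coordChange, (chartAt E c).left_inv hτ]

/-- The curve that is given by `α` in the chart around `c`. -/
theorem hasVelocity_chart_symm {α : ℝ → E} {v : E} {t : ℝ} {c : X}
    (hα : α t ∈ (chartAt E c).target)
    (h : HasDerivAt α (chartDeriv c ((chartAt E c).symm (α t)) v) t) :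
    HasVelocity (fun τ => (chartAt E c).symm (α τ)) v t := by
  refine hasVelocity_of_hasDerivAt (ContinuousAt.comp (f := α)
    ((chartAt E c).continuousAt_symm hα) h.continuousAt) ((chartAt E c).map_target hα) ?_
  refine h.congr_of_eventuallyEq ?_
  filter_upwards [h.continuousAt.eventually ((chartAt E c).open_target.mem_nhds hα)] with τ hτ
  exact (chartAt E c).right_inv hτ

end Velocity

/-! ### Linear families of vector fields on a manifold -/

section Family

variable {E : Type*} [NormedAddCommGroup E] [NormedSpace ℝ E]
  {X : Type*} [TopologicalSpace X] [ChartedSpace E X]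
  {W : Type*} [NormedAddCommGroup W] [NormedSpace ℝ W]

/-- The family `V` of vector fields in the chart around `c`. -/
noncomputable def localField (V : X → W →L[ℝ] E) (c : X) (y : E) : W →L[ℝ] E :=
  (chartDeriv c ((chartAt E c).symm y)).comp (V ((chartAt E c).symm y))

theorem localField_chart (V : X → W →L[ℝ] E) {c x : X} (hx : x ∈ (chartAt E c).source) :
    localField V c (chartAt E c x) = (chartDeriv c x).comp (V x) := by
  simp [localField, (chartAt E c).left_inv hx]

variable [IsManifold 𝓘(ℝ, E) ∞ X]

/-- Smoothness in charts is translated into C¹ regularity of a section of the tangent bundle, the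
form in which uniqueness and extension of integral curves apply. -/
theorem contMDiff_section (V : X → W →L[ℝ] E)
    (hV : ∀ c, ContDiffOn ℝ ∞ (localField V c) (chartAt E c).target) (ζ : W) :
    ContMDiff 𝓘(ℝ, E) 𝓘(ℝ, E).tangent 1
      (fun x => (⟨x, V x ζ⟩ : TangentBundle 𝓘(ℝ, E) X)) := by
  intro c
  refine (Bundle.contMDiffAt_section (IB := 𝓘(ℝ, E)) (F := E)
    (E := fun x : X => TangentSpace 𝓘(ℝ, E) x) c).2 ?_
  have h1 : ContDiffAt ℝ 1 (fun y => localField V c y ζ) (chartAt E c c) :=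
    (((hV c).contDiffAt ((chartAt E c).open_target.mem_nhds (mem_chart_target E c))).clm_apply
      contDiffAt_const).of_le (by norm_cast)
  have h2 : ContMDiffAt 𝓘(ℝ, E) 𝓘(ℝ, E) 1 (fun x : X => localField V c (chartAt E c x) ζ) c := by
    refine ContMDiffAt.comp (x := c) (g := fun y => localField V c y ζ) (f := chartAt E c)
      h1.contMDiffAt ?_
    have : IsManifold 𝓘(ℝ, E) 1 X := IsManifold.of_le (n := ∞) (by norm_cast)
    exact (contMDiffOn_chart (I := 𝓘(ℝ, E)) (n := 1) (x := c)).contMDiffAt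
      ((chartAt E c).open_source.mem_nhds (mem_chart_source E c))
  refine h2.congr_of_eventuallyEq ?_
  filter_upwards [(chartAt E c).open_source.mem_nhds (mem_chart_source E c)] with x hx
  rw [localField_chart V hx]
  rw [TangentBundle.trivializationAt_apply]
  simp only [mfld_simps, fderivWithin_univ]
  rfl

end Family

/-! ### Local flows, completeness and time-one maps on a compact manifold. -/

section Family

variable {E : Type*} [NormedAddCommGroup E] [NormedSpace ℝ E]
  {X : Type*} [TopologicalSpace X] [ChartedSpace E X]
  {W : Type*} [NormedAddCommGroup W] [NormedSpace ℝ W]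

theorem exists_contDiff_hasCompactSupport_eqOn [FiniteDimensional ℝ E] {F : Type*} [NormedAddCommGroup F]
    [NormedSpace ℝ F] {f : E → F} {U : Set E} (hU : IsOpen U) (hf : ContDiffOn ℝ ∞ f U) {y : E}
    (hy : y ∈ U) : ∃ (g : E → F) (r : ℝ), 0 < r ∧ ContDiff ℝ ∞ g ∧ HasCompactSupport g ∧
      ball y r ⊆ U ∧ EqOn g f (ball y r) := by
  obtain ⟨R, hR, hRU⟩ := Metric.isOpen_iff.1 hU y hy
  let b : ContDiffBump y := ⟨R / 4, R / 2, by positivity, by linarith⟩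
  have hsupp : tsupport (b : E → ℝ) ⊆ U := by
    rw [b.tsupport_eq]
    exact (closedBall_subset_ball (by change R / 2 < R; linarith)).trans hRU
  refine ⟨fun z => b z • f z, R / 4, by positivity, contDiff_iff_contDiffAt.2 fun z => ?_,
    b.hasCompactSupport.smul_right, (ball_subset_ball (by linarith)).trans hRU, fun z hz => ?_⟩
  · by_cases hz : z ∈ U
    · exact b.contDiffAt.smul (hf.contDiffAt (hU.mem_nhds hz))
    · have h1 : z ∉ tsupport (b : E → ℝ) := fun h => hz (hsupp h)
      refine (contDiffAt_const (c := (0 : F))).congr_of_eventuallyEq ?_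
      filter_upwards [notMem_tsupport_iff_eventuallyEq.1 h1] with w hw
      simp [hw]
  · simp [b.one_of_mem_closedBall (ball_subset_closedBall hz)]

theorem _root_.ContDiff.exists_bounds_of_hasCompactSupport {F : Type*} [NormedAddCommGroup F]
    [NormedSpace ℝ F] {g : E → F} (hg : ContDiff ℝ ∞ g) (hgc : HasCompactSupport g) :
    (∃ K : ℝ≥0, LipschitzWith K g) ∧ (∃ C : ℝ≥0, LipschitzWith C (fderiv ℝ g)) ∧
      ∃ M : ℝ≥0, ∀ y, ‖g y‖ ≤ M := by
  refine ⟨?_, ?_, ?_⟩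
  · exact ContDiff.lipschitzWith_of_hasCompactSupport (𝕂 := ℝ) (n := ∞) hgc hg (by simp)
  · have hgd : ContDiff ℝ 1 (fderiv ℝ g) := hg.fderiv_right (by norm_cast)
    exact ContDiff.lipschitzWith_of_hasCompactSupport (𝕂 := ℝ) (hgc.fderiv ℝ) hgd one_ne_zero
  · obtain ⟨M, hM⟩ := hgc.exists_bound_of_continuous hg.continuous
    exact ⟨M.toNNReal, fun y => (hM y).trans (Real.le_coe_toNNReal M)⟩

/-- In the chart around `c`, the integral curves of the vector fields `V · ζ` with `‖ζ‖ < ρ` that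
start in `N` are integral curves of a family `g` of vector fields with uniform bounds. -/
structure IsLocalFlow (V : X → W →L[ℝ] E) (c : X) (g : E → W →L[ℝ] E)
    (g' : E → E →L[ℝ] W →L[ℝ] E) (K M C : ℝ≥0) (ρ : ℝ) (N : Set X) : Prop where
  hasFDerivAt : ∀ y, HasFDerivAt g (g' y) y
  lipschitz : LipschitzWith K g
  lipschitz' : LipschitzWith C g'
  norm_le : ∀ y, ‖g y‖ ≤ M
  pos : 0 < ρ
  isOpen : IsOpen N
  mem : c ∈ N
  subset : N ⊆ (chartAt E c).source
  exists_curve : ∀ ζ : W, ‖ζ‖ < ρ → ∀ x ∈ N, ∃ γ : ℝ → X, γ 0 = x ∧ ∀ s ∈ Ioo (-2 : ℝ) 2,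
    γ s ∈ (chartAt E c).source ∧ g =ᶠ[𝓝 (chartAt E c (γ s))] localField V c ∧
    HasVelocity γ (V (γ s) ζ) s

/-- The speed is at most `M * ‖ζ‖`, so for |s| < 2 the curve moves by at most r/2. Starting in the
half ball, it stays in the ball of radius `r`; this explains the constant `r / (4 * (M + 1))`. -/
theorem exists_hasDerivAt_Ioo_mem_ball [CompleteSpace E] {g : E → W →L[ℝ] E} {K M : ℝ≥0}
    (hK : LipschitzWith K g) (hM : ∀ y, ‖g y‖ ≤ M) {r : ℝ} (hr : 0 < r) {ζ : W}
    (hζ : ‖ζ‖ < r / (4 * (M + 1))) {y z : E} (hz : z ∈ ball y (r / 2)) :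
    ∃ α : ℝ → E, α 0 = z ∧ ∀ s ∈ Ioo (-2 : ℝ) 2,
      α s ∈ ball y r ∧ HasDerivAt α (g (α s) ζ) s := by
  have hlip : LipschitzWith (K * ‖ζ‖₊) (fun y => g y ζ) := by
    refine LipschitzWith.of_dist_le_mul fun a b => ?_
    rw [dist_eq_norm, dist_eq_norm, ← sub_apply]
    refine ((g a - g b).le_opNorm ζ).trans ?_
    have := hK.norm_sub_le a b
    push_cast
    calc _ ≤ K * ‖a - b‖ * ‖ζ‖ := by gcongr
      _ = _ := by ring
  have hbd : ∀ y, ‖g y ζ‖ ≤ (M * ‖ζ‖₊ : ℝ≥0) := fun y => by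
    push_cast
    exact ((g y).le_opNorm ζ).trans (mul_le_mul_of_nonneg_right (hM y) (norm_nonneg _))
  obtain ⟨α, hα0, hα⟩ := exists_hasDerivAt_Ioo_of_lipschitzWith hlip hbd 2 two_pos z
  refine ⟨α, hα0, fun s hs => ⟨?_, hα s hs⟩⟩
  have h1 := (convex_Ioo (-2 : ℝ) 2).norm_image_sub_le_of_norm_hasDerivWithin_le
    (fun t ht => (hα t ht).hasDerivWithinAt) (fun t _ => hbd (α t))
    (show (0 : ℝ) ∈ Ioo (-2 : ℝ) 2 by simp) hs
  rw [hα0, sub_zero, Real.norm_eq_abs] at h1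
  push_cast at h1
  have h2 : |s| ≤ 2 := (abs_lt.2 hs).le
  have h3 : (M : ℝ) * ‖ζ‖ * |s| ≤ r / 2 := by
    calc (M : ℝ) * ‖ζ‖ * |s| ≤ (M + 1) * (r / (4 * (M + 1))) * 2 := by
          gcongr; linarith
      _ = r / 2 := by field_simp; norm_num
  rw [mem_ball] at hz ⊢
  calc dist (α s) y ≤ dist (α s) z + dist z y := dist_triangle _ _ _
    _ < r / 2 + r / 2 := by rw [dist_eq_norm (α s)]; linarith
    _ = r := by ring

/-- A bump function turns the field in the chart into a compactly supported one, which has global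
bounds. Curves from the half ball never leave the ball where the cut-off is inactive, so they solve
the original equation. -/
theorem exists_isLocalFlow {V : X → W →L[ℝ] E}
    (hV : ∀ c, ContDiffOn ℝ ∞ (localField V c) (chartAt E c).target) (c : X)
    [IsManifold 𝓘(ℝ, E) ∞ X] [FiniteDimensional ℝ E] :
    ∃ g g' K M C ρ N, IsLocalFlow V c g g' K M C ρ N := by
  obtain ⟨g, r, hr, hg, hgc, hrU, hgeq⟩ := exists_contDiff_hasCompactSupport_eqOn
    (chartAt E c).open_target (hV c) (mem_chart_target E c)
  obtain ⟨⟨K, hK⟩, ⟨C, hC⟩, M, hM⟩ := hg.exists_bounds_of_hasCompactSupport hgc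
  have hd := hg.differentiable (by simp)
  have hgeq' : ∀ z ∈ ball (chartAt E c c) r, g =ᶠ[𝓝 z] localField V c := fun z hz =>
    hgeq.eventuallyEq_of_mem (isOpen_ball.mem_nhds hz)
  refine ⟨g, fderiv ℝ g, K, M, C, r / (4 * (M + 1)),
    (chartAt E c).source ∩ chartAt E c ⁻¹' ball (chartAt E c c) (r / 2), ?_⟩
  refine ⟨fun y => (hd y).hasFDerivAt, hK, hC, hM, by positivity,
    (chartAt E c).isOpen_inter_preimage isOpen_ball,
    ⟨mem_chart_source E c, mem_ball_self (half_pos hr)⟩, inter_subset_left, ?_⟩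
  rintro ζ hζ x ⟨hx, hx'⟩
  obtain ⟨α, hα0, hα⟩ := exists_hasDerivAt_Ioo_mem_ball hK hM hr hζ hx'
  refine ⟨fun s => (chartAt E c).symm (α s), ?_, fun s hs => ?_⟩
  · simp only [hα0]
    exact (chartAt E c).left_inv hx
  obtain ⟨h1, h2⟩ := hα s hs
  refine ⟨(chartAt E c).map_target (hrU h1), ?_, hasVelocity_chart_symm (hrU h1) ?_⟩
  · rw [(chartAt E c).right_inv (hrU h1)]
    exact hgeq' _ h1
  · rw [hgeq h1] at h2
    exact h2

variable [IsManifold 𝓘(ℝ, E) ∞ X]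

theorem eqOn_Ioo_of_hasVelocity [CompleteSpace E] [T2Space X] {V : X → W →L[ℝ] E}
    (hV : ∀ c, ContDiffOn ℝ ∞ (localField V c) (chartAt E c).target) {ζ : W} {a b t₀ : ℝ}
    (ht₀ : t₀ ∈ Ioo a b) {γ γ' : ℝ → X} (hγ : ∀ t ∈ Ioo a b, HasVelocity γ (V (γ t) ζ) t)
    (hγ' : ∀ t ∈ Ioo a b, HasVelocity γ' (V (γ' t) ζ) t) (h : γ t₀ = γ' t₀) :
    EqOn γ γ' (Ioo a b) := by
  have : IsManifold 𝓘(ℝ, E) 1 X := IsManifold.of_le (n := ∞) (by norm_cast)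
  exact isMIntegralCurveOn_Ioo_eqOn_of_contMDiff_boundaryless (I := 𝓘(ℝ, E)) ht₀
    (contMDiff_section V hV ζ)
    (fun t ht => (hasVelocity_iff_hasMFDerivAt.1 (hγ t ht)).hasMFDerivWithinAt)
    (fun t ht => (hasVelocity_iff_hasMFDerivAt.1 (hγ' t ht)).hasMFDerivWithinAt) h

theorem eq_of_hasVelocity [CompleteSpace E] [T2Space X] {V : X → W →L[ℝ] E}
    (hV : ∀ c, ContDiffOn ℝ ∞ (localField V c) (chartAt E c).target) {ζ : W}
    {γ γ' : ℝ → X} (hγ : ∀ t, HasVelocity γ (V (γ t) ζ) t)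
    (hγ' : ∀ t, HasVelocity γ' (V (γ' t) ζ) t) (h : γ 0 = γ' 0) : γ = γ' := by
  funext t
  have ht := abs_lt.1 (lt_add_one |t|)
  exact eqOn_Ioo_of_hasVelocity hV (a := -(|t| + 1)) (b := |t| + 1) (t₀ := 0)
    ⟨by linarith [abs_nonneg t], by positivity⟩ (fun t _ => hγ t) (fun t _ => hγ' t) h ht

/-- `F ζ x` is the integral curve of the vector field `V · ζ` that starts at `x`. -/
def IsFlow (V : X → W →L[ℝ] E) (F : W → X → ℝ → X) : Prop :=
  ∀ ζ x, F ζ x 0 = x ∧ ∀ t, HasVelocity (F ζ x) (V (F ζ x t) ζ) t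

theorem exists_uniform_isLocalFlow [FiniteDimensional ℝ E] [CompactSpace X] {V : X → W →L[ℝ] E}
    (hV : ∀ c, ContDiffOn ℝ ∞ (localField V c) (chartAt E c).target) :
    ∃ ρ > 0, ∀ x : X, ∃ c g g' K M C ρ' N, ρ ≤ ρ' ∧ x ∈ N ∧ IsLocalFlow V c g g' K M C ρ' N := by
  choose g g' K M C ρ N h using fun c => exists_isLocalFlow hV c
  obtain ⟨t, ht⟩ := isCompact_univ.elim_nhds_subcover N
    (fun c _ => (h c).isOpen.mem_nhds (h c).mem)
  have hsub : ∀ x : X, ∃ c ∈ t, x ∈ N c := fun x => by simpa using ht.2 (mem_univ x)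
  rcases isEmpty_or_nonempty X with hX | ⟨⟨x⟩⟩
  · exact ⟨1, one_pos, fun x => hX.elim x⟩
  · obtain ⟨c₀, hc₀, -⟩ := hsub x
    have htn : t.Nonempty := ⟨c₀, hc₀⟩
    refine ⟨t.inf' htn ρ, (Finset.lt_inf'_iff htn).2 fun c _ => (h c).pos, fun x => ?_⟩
    obtain ⟨c, hc, hx⟩ := hsub x
    exact ⟨c, g c, g' c, K c, M c, C c, ρ c, N c, Finset.inf'_le _ hc, hx, h c⟩

theorem exists_isFlow [FiniteDimensional ℝ E] [CompactSpace X] [T2Space X] {V : X → W →L[ℝ] E}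
    (hV : ∀ c, ContDiffOn ℝ ∞ (localField V c) (chartAt E c).target) :
    ∃ F : W → X → ℝ → X, IsFlow V F := by
  obtain ⟨ρ, hρ, hloc⟩ := exists_uniform_isLocalFlow hV
  suffices ∀ ζ x, ∃ γ : ℝ → X, γ 0 = x ∧ ∀ t, HasVelocity γ (V (γ t) ζ) t by
    choose F hF using this
    exact ⟨F, hF⟩
  have : IsManifold 𝓘(ℝ, E) 1 X := IsManifold.of_le (n := ∞) (by norm_cast)
  intro ζ x
  -- Rescaling makes the parameter shorter than `ρ`, where integral curves exist on (−2, 2) from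
  -- every starting point. This uniform lifetime extends them to all times, and time is then
  -- rescaled back.
  set a : ℝ := ρ / (‖ζ‖ + 1) with ha
  have ha0 : 0 < a := by positivity
  have hsmall : ‖a • ζ‖ < ρ := by
    rw [norm_smul, Real.norm_of_nonneg ha0.le, ha, div_mul_eq_mul_div, div_lt_iff₀ (by positivity)]
    nlinarith [norm_nonneg ζ]
  obtain ⟨γ, h0, hγ⟩ := exists_isMIntegralCurve_of_isMIntegralCurveOn (I := 𝓘(ℝ, E))
    (contMDiff_section V hV (a • ζ)) two_pos (fun x => by
      obtain ⟨c, g, g', K, M, C, ρ', N, hρ', hx, h⟩ := hloc x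
      obtain ⟨γ, h0, hγ⟩ := h.exists_curve (a • ζ) (hsmall.trans_le hρ') x hx
      exact ⟨γ, h0, fun t ht =>
        (hasVelocity_iff_hasMFDerivAt.1 (hγ t ht).2.2).hasMFDerivWithinAt⟩) x
  refine ⟨fun t => γ (a⁻¹ * t), by simpa using h0, fun t => ?_⟩
  have h1 : HasVelocity γ (V (γ (a⁻¹ * t)) (a • ζ)) (a⁻¹ * t) :=
    hasVelocity_iff_hasMFDerivAt.2 (hγ _)
  have h2 := h1.comp (f := fun t => a⁻¹ * t) (a := a⁻¹) (t := t)
    (by simpa using (hasDerivAt_id t).const_mul a⁻¹)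
  rwa [map_smul, smul_smul, inv_mul_cancel₀ ha0.ne', one_smul] at h2

variable {V : X → W →L[ℝ] E} {F : W → X → ℝ → X}

theorem IsFlow.eq_of_hasVelocity [CompleteSpace E] [T2Space X] (hF : IsFlow V F)
    (hV : ∀ c, ContDiffOn ℝ ∞ (localField V c) (chartAt E c).target) {ζ : W} {γ : ℝ → X}
    (hγ : ∀ t, HasVelocity γ (V (γ t) ζ) t) : F ζ (γ 0) = γ :=
  NessUniqueness.eq_of_hasVelocity hV (hF ζ (γ 0)).2 hγ (hF ζ (γ 0)).1

theorem IsFlow.two_smul [CompleteSpace E] [T2Space X] (hF : IsFlow V F)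
    (hV : ∀ c, ContDiffOn ℝ ∞ (localField V c) (chartAt E c).target) (ζ : W) (x : X) :
    F ((2 : ℝ) • ζ) x 1 = F ζ (F ζ x 1) 1 := by
  have h1 : F ((2 : ℝ) • ζ) x = fun t => F ζ x (2 * t) := by
    have := hF.eq_of_hasVelocity hV (ζ := (2 : ℝ) • ζ) (γ := fun t => F ζ x (2 * t)) fun t => by
      rw [map_smul]
      exact ((hF ζ x).2 (2 * t)).comp (f := fun t => 2 * t)
        (by simpa using (hasDerivAt_id t).const_mul 2)
    simpa [(hF ζ x).1] using this
  have h2 : F ζ (F ζ x 1) = fun t => F ζ x (t + 1) := by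
    have := hF.eq_of_hasVelocity hV (ζ := ζ) (γ := fun t => F ζ x (t + 1)) fun t => by
      have := ((hF ζ x).2 (t + 1)).comp (f := fun t => t + 1) ((hasDerivAt_id t).add_const 1)
      rwa [one_smul] at this
    simpa using this
  rw [h1, h2]
  norm_num

/-- By uniqueness of integral curves, the global flow coincides with the local curve, so for small
`ζ` it stays in a single chart up to time one. -/
theorem IsLocalFlow.hasDerivAt_chart [CompleteSpace E] [T2Space X] {c : X} {g : E → W →L[ℝ] E}
    {g' : E → E →L[ℝ] W →L[ℝ] E} {K M C : ℝ≥0} {ρ : ℝ} {N : Set X}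
    (h : IsLocalFlow V c g g' K M C ρ N) (hF : IsFlow V F)
    (hV : ∀ c, ContDiffOn ℝ ∞ (localField V c) (chartAt E c).target) {ζ : W} (hζ : ‖ζ‖ < ρ)
    {x : X} (hx : x ∈ N) {s : ℝ} (hs : s ∈ Icc (0 : ℝ) 1) :
    F ζ x s ∈ (chartAt E c).source ∧ g =ᶠ[𝓝 (chartAt E c (F ζ x s))] localField V c ∧
    HasDerivAt (fun s => chartAt E c (F ζ x s)) (g (chartAt E c (F ζ x s)) ζ) s := by
  obtain ⟨γ, h0, hγ⟩ := h.exists_curve ζ hζ x hx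
  have heq : EqOn γ (F ζ x) (Ioo (-2) 2) := eqOn_Ioo_of_hasVelocity hV (t₀ := 0) (by simp)
    (fun t ht => (hγ t ht).2.2) (fun t _ => (hF ζ x).2 t) (by rw [h0, (hF ζ x).1])
  have hs' : s ∈ Ioo (-2 : ℝ) 2 := ⟨by linarith [hs.1], by linarith [hs.2]⟩
  obtain ⟨h1, h2, -⟩ := hγ s hs'
  rw [heq hs'] at h1 h2
  refine ⟨h1, h2, ?_⟩
  have := ((hF ζ x).2 s).hasDerivAt h1
  rw [h2.self_of_nhds, localField_chart V h1]
  exact this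

theorem IsLocalFlow.continuousAt [CompleteSpace E] [T2Space X] {c : X} {g : E → W →L[ℝ] E}
    {g' : E → E →L[ℝ] W →L[ℝ] E} {K M C : ℝ≥0} {ρ : ℝ} {N : Set X}
    (h : IsLocalFlow V c g g' K M C ρ N) (hF : IsFlow V F)
    (hV : ∀ c, ContDiffOn ℝ ∞ (localField V c) (chartAt E c).target) {ζ : W} (hζ : ‖ζ‖ < ρ)
    {x : X} (hx : x ∈ N) : ContinuousAt (fun p : W × X => F p.1 p.2 1) (ζ, x) := by
  have hone : (1 : ℝ) ∈ Icc (0 : ℝ) 1 := by simp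
  have hev : ∀ᶠ p : W × X in 𝓝 (ζ, x), ‖p.1‖ < ρ ∧ p.2 ∈ N :=
    (continuous_fst.norm.continuousAt.eventually (gt_mem_nhds hζ)).and
      (continuous_snd.continuousAt.eventually (h.isOpen.mem_nhds hx))
  obtain ⟨h1, -, -⟩ := h.hasDerivAt_chart hF hV hζ hx hone
  have hchart : ContinuousAt (fun p : W × X => chartAt E c (F p.1 p.2 1)) (ζ, x) := by
    rw [ContinuousAt, tendsto_iff_norm_sub_tendsto_zero]
    have hc : ContinuousAt (fun p : W × X => chartAt E c p.2) (ζ, x) :=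
      ContinuousAt.comp (f := Prod.snd) (g := chartAt E c)
        ((chartAt E c).continuousAt (h.subset hx)) continuousAt_snd
    have hlim : Tendsto (fun p : W × X => (‖chartAt E c p.2 - chartAt E c x‖ + M * ‖p.1 - ζ‖) *
        Real.exp (K * ‖p.1‖ + 1)) (𝓝 (ζ, x)) (𝓝 0) := by
      have : ContinuousAt (fun p : W × X => (‖chartAt E c p.2 - chartAt E c x‖ + M * ‖p.1 - ζ‖) *
        Real.exp (K * ‖p.1‖ + 1)) (ζ, x) := by fun_prop
      simpa [ContinuousAt] using this
    refine squeeze_zero' (Eventually.of_forall fun _ => norm_nonneg _) ?_ hlim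
    filter_upwards [hev] with p hp
    have := dist_le_of_linear_family h.lipschitz h.norm_le
      (fun s hs => (h.hasDerivAt_chart hF hV hp.1 hp.2 hs).2.2)
      (fun s hs => (h.hasDerivAt_chart hF hV hζ hx hs).2.2) 1 hone
    simpa [(hF _ _).1] using this
  have h2 := ContinuousAt.comp (g := (chartAt E c).symm)
    (f := fun p : W × X => chartAt E c (F p.1 p.2 1)) (x := (ζ, x))
    ((chartAt E c).continuousAt_symm ((chartAt E c).map_source h1)) hchart
  refine h2.congr_of_eventuallyEq ?_
  filter_upwards [hev] with p hp
  exact ((chartAt E c).left_inv (h.hasDerivAt_chart hF hV hp.1 hp.2 hone).1).symm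

/-- A property of the maps `F ζ · 1` that holds for small `ζ` and is stable under doubling of `ζ`
holds for all `ζ`. -/
theorem forall_of_norm_lt_of_two_smul {P : W → Prop} {ρ : ℝ} (hρ : 0 < ρ)
    (h : ∀ ζ, ‖ζ‖ < ρ → P ζ) (h2 : ∀ ζ, P ζ → P ((2 : ℝ) • ζ)) (ζ : W) : P ζ := by
  obtain ⟨n, hn⟩ := pow_unbounded_of_one_lt (‖ζ‖ / ρ) one_lt_two
  have key : ∀ n : ℕ, ∀ ζ : W, ‖ζ‖ < 2 ^ n * ρ → P ζ := by
    intro n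
    induction n with
    | zero => intro ζ hζ; exact h ζ (by simpa using hζ)
    | succ n ih =>
      intro ζ hζ
      have := h2 ((2 : ℝ)⁻¹ • ζ) (ih _ (by
        rw [norm_smul, norm_inv, Real.norm_two, inv_mul_lt_iff₀ two_pos]
        rwa [pow_succ', mul_assoc] at hζ))
      rwa [smul_smul, mul_inv_cancel₀ two_ne_zero, one_smul] at this
  exact key n ζ ((div_lt_iff₀ hρ).1 hn)

theorem IsFlow.continuous_time_one [FiniteDimensional ℝ E] [T2Space X] [CompactSpace X]
    (hF : IsFlow V F) (hV : ∀ c, ContDiffOn ℝ ∞ (localField V c) (chartAt E c).target) :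
    Continuous (fun p : W × X => F p.1 p.2 1) := by
  obtain ⟨ρ, hρ, hloc⟩ := exists_uniform_isLocalFlow hV
  have := FiniteDimensional.complete ℝ E
  suffices ∀ ζ : W, ∀ x : X, ContinuousAt (fun p : W × X => F p.1 p.2 1) (ζ, x) from
    continuous_iff_continuousAt.2 fun p => this p.1 p.2
  refine forall_of_norm_lt_of_two_smul hρ (fun ζ hζ x => ?_) (fun ζ hζ x => ?_)
  · obtain ⟨c, g, g', K, M, C, ρ', N, hρ', hx, h⟩ := hloc x
    exact h.continuousAt hF hV (hζ.trans_le hρ') hx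
  · have e : (fun p : W × X => F p.1 p.2 1) = fun p =>
        F ((2 : ℝ)⁻¹ • p.1) (F ((2 : ℝ)⁻¹ • p.1) p.2 1) 1 := by
      funext p
      rw [← hF.two_smul hV, smul_smul, mul_inv_cancel₀ two_ne_zero, one_smul]
    have e2 : (2 : ℝ)⁻¹ • (2 : ℝ) • ζ = ζ := by
      rw [smul_smul, inv_mul_cancel₀ two_ne_zero, one_smul]
    have hhalf : ContinuousAt (fun p : W × X => ((2 : ℝ)⁻¹ • p.1, p.2)) ((2 : ℝ) • ζ, x) := by
      fun_prop
    have h1 : ContinuousAt (fun p : W × X => F ((2 : ℝ)⁻¹ • p.1) p.2 1) ((2 : ℝ) • ζ, x) := by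
      refine ContinuousAt.comp (g := fun p : W × X => F p.1 p.2 1)
        (f := fun p : W × X => ((2 : ℝ)⁻¹ • p.1, p.2)) ?_ hhalf
      simp only [e2]
      exact hζ x
    rw [e]
    refine ContinuousAt.comp (g := fun p : W × X => F p.1 p.2 1)
      (f := fun p : W × X => ((2 : ℝ)⁻¹ • p.1, F ((2 : ℝ)⁻¹ • p.1) p.2 1)) ?_
      ((continuous_fst.const_smul _).continuousAt.prodMk h1)
    simp only [e2]
    exact hζ _

/-- The first variation of the time-one map: if `ζ` and `y` have velocities `w` and `V y κ(0)`, then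
`F ζ y 1` has velocity `V (F ζ y 1) κ(1)`, where `κ` solves `κ' = [ζ, κ] + w`. -/
theorem IsFlow.hasVelocity_time_one [FiniteDimensional ℝ E] [T2Space X] [CompactSpace X]
    (hF : IsFlow V F) (hV : ∀ c, ContDiffOn ℝ ∞ (localField V c) (chartAt E c).target)
    {br : W →ₗ[ℝ] W →ₗ[ℝ] W} (hbr : ∀ c, ∀ y ∈ (chartAt E c).target, ∀ ζ κ,
      fderiv ℝ (localField V c) y (localField V c y ζ) κ + localField V c y (br ζ κ) =
        fderiv ℝ (localField V c) y (localField V c y κ) ζ)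
    {ζ : ℝ → W} {w : W} {t : ℝ} (hζ : HasDerivAt ζ w t) {κ : ℝ → W}
    (hκ : ∀ s, HasDerivAt κ (br (ζ t) (κ s) + w) s) {y : ℝ → X}
    (hy : HasVelocity y (V (y t) (κ 0)) t) :
    HasVelocity (fun τ => F (ζ τ) (y τ) 1) (V (F (ζ t) (y t) 1) (κ 1)) t := by
  obtain ⟨ρ, hρ, hloc⟩ := exists_uniform_isLocalFlow hV
  have := FiniteDimensional.complete ℝ E
  suffices ∀ (ζ₀ : W) (ζ : ℝ → W), ζ t = ζ₀ → ∀ (w : W), HasDerivAt ζ w t → ∀ (κ : ℝ → W),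
      (∀ s, HasDerivAt κ (br (ζ t) (κ s) + w) s) → ∀ (y : ℝ → X),
      HasVelocity y (V (y t) (κ 0)) t →
      HasVelocity (fun τ => F (ζ τ) (y τ) 1) (V (F (ζ t) (y t) 1) (κ 1)) t from
    this (ζ t) ζ rfl w hζ κ hκ y hy
  have hone : (1 : ℝ) ∈ Icc (0 : ℝ) 1 := by simp
  refine forall_of_norm_lt_of_two_smul hρ ?_ ?_
  · rintro _ hζρ ζ rfl w hζ κ hκ y hy
    obtain ⟨c, g, g', K, M, C, ρ', N, hρ', hx, h⟩ := hloc (y t)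
    have hζρ' := hζρ.trans_le hρ'
    obtain ⟨h1, h2, -⟩ := h.hasDerivAt_chart hF hV hζρ' hx hone
    refine hasVelocity_of_hasDerivAt ?_ h1 ?_
    · exact ContinuousAt.comp (g := fun p : W × X => F p.1 p.2 1) (f := fun τ => (ζ τ, y τ))
        (hF.continuous_time_one hV).continuousAt (hζ.continuousAt.prodMk hy.1)
    have key := hasDerivAt_time_one (t := t) h.hasFDerivAt h.lipschitz h.lipschitz' h.norm_le hζ
      (α := fun τ s => chartAt E c (F (ζ τ) (y τ) s)) (br := fun v => br (ζ t) v) (κ := κ) ?_ hκ ?_ ?_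
    · rw [h2.self_of_nhds, localField_chart V h1] at key
      exact key
    · filter_upwards [hζ.continuousAt.norm.eventually (gt_mem_nhds hζρ'),
        hy.1.eventually (h.isOpen.mem_nhds hx)] with τ hτ hτ' s hs
      exact (h.hasDerivAt_chart hF hV hτ hτ' hs).2.2
    · intro s hs
      obtain ⟨h3, h4, -⟩ := h.hasDerivAt_chart hF hV hζρ' hx hs
      -- The cut-off field agrees with the original one on a neighbourhood of each point of the
      -- curve, so their derivatives agree as well and the commutator identity applies to it.
      have h5 : g' (chartAt E c (F (ζ t) (y t) s)) =
          fderiv ℝ (localField V c) (chartAt E c (F (ζ t) (y t) s)) := by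
        rw [← h4.fderiv_eq, (h.hasFDerivAt _).fderiv]
      simp only [h5, h4.self_of_nhds]
      exact hbr c _ ((chartAt E c).map_source h3) _ _
    · have h3 : y t ∈ (chartAt E c).source := h.subset hx
      obtain ⟨-, h4, -⟩ := h.hasDerivAt_chart hF hV hζρ' hx (s := 0) (by simp)
      rw [(hF _ _).1] at h4
      simp only [(hF _ _).1]
      rw [h4.self_of_nhds, localField_chart V h3]
      exact hy.hasDerivAt h3
  · intro ζ₀ ih ζ hζ₀ w hζ κ hκ y hy
    have e : (fun τ => F (ζ τ) (y τ) 1) = fun τ =>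
        F ((2 : ℝ)⁻¹ • ζ τ) (F ((2 : ℝ)⁻¹ • ζ τ) (y τ) 1) 1 := by
      funext τ
      rw [← hF.two_smul hV, smul_smul, mul_inv_cancel₀ two_ne_zero, one_smul]
    have e0 : (2 : ℝ)⁻¹ • ζ t = ζ₀ := by
      rw [hζ₀, smul_smul, inv_mul_cancel₀ two_ne_zero, one_smul]
    -- The solution `κ` is cut into its two halves, reparametrised to unit time: `a = 0` serves the
    -- first application of the time-one map of `ζ₀`, and `a = 1/2` the second. The rescaling halves
    -- both the parameter and the forcing `w`.
    have hκ' : ∀ a s : ℝ, HasDerivAt (fun s => κ ((2 : ℝ)⁻¹ * s + a))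
        (br ((2 : ℝ)⁻¹ • ζ t) (κ ((2 : ℝ)⁻¹ * s + a)) + (2 : ℝ)⁻¹ • w) s := by
      intro a s
      have h1 : HasDerivAt (fun s : ℝ => (2 : ℝ)⁻¹ * s + a) (2 : ℝ)⁻¹ s := by
        simpa using ((hasDerivAt_id s).const_mul (2 : ℝ)⁻¹).add_const a
      have := (hκ ((2 : ℝ)⁻¹ * s + a)).scomp s h1
      simpa [smul_add, Function.comp_def] using this
    have h1 := ih (fun τ => (2 : ℝ)⁻¹ • ζ τ) e0 _ (hζ.const_smul _) _ (hκ' 0) y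
      (by simpa using hy)
    have h2 := ih (fun τ => (2 : ℝ)⁻¹ • ζ τ) e0 _ (hζ.const_smul _) _ (hκ' 2⁻¹)
      (fun τ => F ((2 : ℝ)⁻¹ • ζ τ) (y τ) 1) (by simpa using h1)
    have e2 := congrFun e t
    rw [e, e2]
    norm_num at h2 ⊢
    exact h2

end Family

/-! ### The exponential map of a closed subgroup of the unitary group -/

section BanachAlgebra

open NormedSpace

variable {A V : Type*} [NormedRing A] [NormedAlgebra ℝ A] [CompleteSpace A]
  [FiniteDimensional ℝ A] [NormedAddCommGroup V] [NormedSpace ℝ V]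

theorem hasDerivAt_exp_conj (L : A →ₗ[ℝ] V) (a b : A) :
    HasDerivAt (fun t : ℝ => L (exp (t • a) * b * exp (-(t • a)))) (L (a * b - b * a)) 0 := by
  have h1 : HasDerivAt (fun t : ℝ => exp (t • a)) a 0 := by
    simpa using hasDerivAt_exp_smul_const a (0 : ℝ)
  have h2 : HasDerivAt (fun t : ℝ => exp (-(t • a))) (-a) 0 := by
    simpa using hasDerivAt_exp_smul_const (-a) (0 : ℝ)
  have h3 := (h1.mul_const b).mul h2
  have h4 := (LinearMap.toContinuousLinearMap L).hasFDerivAt.comp_hasDerivAt (0 : ℝ) h3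
  refine h4.congr_deriv ?_
  simp [sub_eq_add_neg]

/-- Von Neumann's argument. The map a ↦ exp(πa) exp(a − πa), with π a projection onto the Lie
algebra, is a local diffeomorphism at 0. If elements of `S` arbitrarily near 1 were not exponentials
of small Lie algebra elements, their transverse parts m_k would be nonzero with exp(m_k) ∈ S. A
limit direction of the m_k would then be a unit vector in the Lie algebra and in the kernel of π. -/
theorem eventually_exists_exp_eq {S : Set A} (hS : IsClosed S)
    (hmul : ∀ a ∈ S, ∀ b ∈ S, a * b ∈ S)
    (hz : ∀ a : A, exp a ∈ S → ∀ k : ℤ, exp (k • a) ∈ S) {ι : V →ₗ[ℝ] A} {L : A →ₗ[ℝ] V}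
    (hLι : ∀ v, L (ι v) = v) (hι : ∀ v, exp (ι v) ∈ S)
    (hι' : ∀ w : A, (∀ t : ℝ, exp (t • w) ∈ S) → ∃ v, ι v = w) {ε : ℝ} (hε : 0 < ε) :
    ∀ᶠ g in 𝓝 (1 : A), g ∈ S → ∃ v : V, ‖v‖ < ε ∧ exp (ι v) = g := by
  set π : A →L[ℝ] A := LinearMap.toContinuousLinearMap (ι ∘ₗ L) with hπ
  have hπL : ∀ a, π a = ι (L a) := fun _ => rfl
  have hLc : Continuous L := (LinearMap.toContinuousLinearMap L).continuous
  set Ψ : A → A := fun a => exp (π a) * exp (a - π a) with hΨ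
  have hexp : HasStrictFDerivAt (exp : A → A) (1 : A →L[ℝ] A) 0 := hasStrictFDerivAt_exp_zero
  have hΨd : HasStrictFDerivAt Ψ (ContinuousLinearEquiv.refl ℝ A : A →L[ℝ] A) 0 := by
    have h1 : HasStrictFDerivAt (fun a => exp (π a)) π 0 := by
      have := HasStrictFDerivAt.comp (x := (0 : A)) (f := π)
        (g := exp) (by rw [map_zero]; exact hexp) π.hasStrictFDerivAt
      simpa [Function.comp_def] using! this
    have h2 : HasStrictFDerivAt (fun a => exp (a - π a)) (ContinuousLinearMap.id ℝ A - π) 0 := by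
      have := HasStrictFDerivAt.comp (x := (0 : A)) (f := fun a => a - π a)
        (g := exp) (by rw [map_zero, sub_zero]; exact hexp)
        ((hasStrictFDerivAt_id _).sub π.hasStrictFDerivAt)
      simpa [Function.comp_def] using! this
    refine (h1.mul' h2).congr_fderiv ?_
    ext1 a
    simp
  have hΨ0 : Ψ 0 = 1 := by simp [hΨ]
  have hmap := hΨd.map_nhds_eq_of_equiv
  rw [hΨ0] at hmap
  rw [← hmap, eventually_map]
  by_contra hcon
  obtain ⟨x, hx, hxS⟩ := exists_seq_forall_of_frequently (not_eventually.1 hcon)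
  push Not at hxS
  have hLx : Tendsto (fun k => L (x k)) atTop (𝓝 0) := by
    have := (hLc.tendsto 0).comp hx
    rwa [map_zero] at this
  set m : ℕ → A := fun k => x k - π (x k) with hm
  have hm0 : Tendsto m atTop (𝓝 0) := by
    have := hx.sub ((π.continuous.tendsto 0).comp hx)
    simpa using this
  have hLm : ∀ k, L (m k) = 0 := fun k => by simp [hm, hπL, hLι]
  have hmS : ∀ k, exp (m k) ∈ S := by
    intro k
    have h1 : exp (-(π (x k))) * Ψ (x k) = exp (m k) := by
      let _ : NormedAlgebra ℚ A := NormedAlgebra.restrictScalars ℚ ℝ A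
      have : exp (-(π (x k))) * exp (π (x k)) = 1 := by
        rw [← exp_add_of_commute (Commute.refl _).neg_left, neg_add_cancel, exp_zero]
      rw [hΨ]
      simp only
      rw [← mul_assoc, this, one_mul]
    rw [← h1]
    refine hmul _ ?_ _ (hxS k).1
    rw [hπL, ← map_neg]
    exact hι _
  have hmne : ∀ᶠ k in atTop, m k ≠ 0 := by
    have := hLx.norm.eventually (gt_mem_nhds (by simpa using hε))
    filter_upwards [this] with k hk h0
    refine (hxS k).2 (L (x k)) hk ?_
    change exp (π (x k)) = exp (π (x k)) * exp (m k)
    rw [h0, exp_zero, mul_one]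
  obtain ⟨K, hK⟩ := eventually_atTop.1 hmne
  have hunit : ∀ k, ‖m (k + K)‖⁻¹ • m (k + K) ∈ sphere (0 : A) 1 := by
    intro k
    have := norm_ne_zero_iff.2 (hK (k + K) (Nat.le_add_left _ _))
    simp [norm_smul, this]
  have : ProperSpace A := FiniteDimensional.proper ℝ A
  obtain ⟨w, hw, φ, hφ, hlim⟩ := (isCompact_sphere (0 : A) 1).tendsto_subseq hunit
  have hLw : L w = 0 := by
    refine tendsto_nhds_unique ((hLc.tendsto w).comp hlim) ?_
    simp [Function.comp_def, hLm]
  obtain ⟨v, hv⟩ := hι' w fun t => by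
    let _ : NormedAlgebra ℚ A := NormedAlgebra.restrictScalars ℚ ℝ A
    set d : ℕ → ℝ := fun j => ‖m (φ j + K)‖ with hd
    have hd0 : ∀ j, d j ≠ 0 := fun j => norm_ne_zero_iff.2 (hK _ (Nat.le_add_left _ _))
    have hdlim : Tendsto d atTop (𝓝 0) := by
      have h1 : Tendsto (fun j => φ j + K) atTop atTop :=
        (tendsto_add_atTop_nat K).comp hφ.tendsto_atTop
      have := (hm0.comp h1).norm
      simpa using this
    -- Integer multiples of the short vectors `m` approximate `t • w`, since rounding costs at most
    -- `d j`. Their exponentials are powers of elements of `S`, and `S` is closed.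
    have hfloor : Tendsto (fun j => (⌊t / d j⌋ : ℝ) * d j) atTop (𝓝 t) := by
      rw [tendsto_iff_norm_sub_tendsto_zero]
      refine squeeze_zero (fun _ => norm_nonneg _) (fun j => ?_) hdlim
      have hpos : 0 < d j := lt_of_le_of_ne (norm_nonneg _) (hd0 j).symm
      have h1 : (⌊t / d j⌋ : ℝ) * d j ≤ t := by
        have := mul_le_mul_of_nonneg_right (Int.floor_le (t / d j)) hpos.le
        rwa [div_mul_cancel₀ _ (hd0 j)] at this
      have h2 : t ≤ (⌊t / d j⌋ : ℝ) * d j + d j := by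
        have := mul_le_mul_of_nonneg_right (Int.lt_floor_add_one (t / d j)).le hpos.le
        rwa [div_mul_cancel₀ _ (hd0 j), add_mul, one_mul] at this
      rw [Real.norm_eq_abs, abs_le]
      constructor <;> linarith
    have h3 : Tendsto (fun j => exp (((⌊t / d j⌋ : ℝ) * d j) • ((d j)⁻¹ • m (φ j + K)))) atTop
        (𝓝 (exp (t • w))) := (exp_continuous.tendsto _).comp (hfloor.smul hlim)
    refine hS.mem_of_tendsto h3 (Eventually.of_forall fun j => ?_)
    rw [smul_smul, mul_assoc, mul_inv_cancel₀ (hd0 j), mul_one, Int.cast_smul_eq_zsmul]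
    exact hz _ (hmS _) _
  have hw0 : w = 0 := by
    rw [← hv, hLι] at hLw
    rw [← hv, hLw, map_zero]
  simp [hw0] at hw

end BanachAlgebra

section Group

variable {n : ℕ} {G : ClosedSubgroup (Matrix.unitaryGroup (Fin n) ℂ)}

/-- The matrix of an element of `G`. -/
def toMat (u : G) : Matrix (Fin n) (Fin n) ℂ := ((u : Matrix.unitaryGroup (Fin n) ℂ) : Matrix _ _ ℂ)

theorem toMat_injective : Function.Injective (toMat : G → Matrix (Fin n) (Fin n) ℂ) :=
  fun _ _ h => Subtype.ext (Subtype.ext h)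

theorem toMat_mul (u v : G) : toMat (u * v) = toMat u * toMat v := rfl

theorem toMat_one : toMat (1 : G) = 1 := rfl

theorem toMat_mul_inv (u : G) : toMat u * toMat u⁻¹ = 1 := by
  rw [← toMat_mul, mul_inv_cancel, toMat_one]

theorem toMat_inv (u : G) : toMat u⁻¹ = (toMat u)⁻¹ :=
  (Matrix.inv_eq_right_inv (toMat_mul_inv u)).symm

theorem isUnit_toMat (u : G) : IsUnit (toMat u) :=
  (Unitary.toUnits (u : Matrix.unitaryGroup (Fin n) ℂ)).isUnit

theorem toMat_expG (ξ : lieAlg G) :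
    toMat (expG ξ) = NormedSpace.exp (ξ : Matrix (Fin n) (Fin n) ℂ) := rfl

theorem coe_adj (u : G) (ξ : lieAlg G) :
    (adj u ξ : Matrix (Fin n) (Fin n) ℂ) = toMat u * ξ * toMat u⁻¹ := rfl

theorem expG_zero : expG (0 : lieAlg G) = 1 :=
  toMat_injective (by simp [toMat_expG, toMat_one])

theorem expG_add_smul (s t : ℝ) (ξ : lieAlg G) :
    expG ((s + t) • ξ) = expG (s • ξ) * expG (t • ξ) := by
  refine toMat_injective ?_
  rw [toMat_mul, toMat_expG, toMat_expG, toMat_expG]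
  simp only [Submodule.coe_smul, add_smul]
  exact Matrix.exp_add_of_commute _ _ ((Commute.refl _).smul_left _ |>.smul_right _)

theorem expG_adj (u : G) (ξ : lieAlg G) : expG (adj u ξ) = u * expG ξ * u⁻¹ := by
  refine toMat_injective ?_
  rw [toMat_mul, toMat_mul, toMat_expG, coe_adj, toMat_inv, Matrix.exp_conj _ _ (isUnit_toMat u)]
  rfl

theorem adj_smul (u : G) (c : ℝ) (ξ : lieAlg G) : adj u (c • ξ) = c • adj u ξ := by
  refine Subtype.ext ?_
  simp [coe_adj]

theorem adj_expG_self (t : ℝ) (ξ : lieAlg G) : adj (expG (t • ξ)) ξ = ξ := by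
  refine Subtype.ext ?_
  have h : Commute (ξ : Matrix (Fin n) (Fin n) ℂ) (toMat (expG (t • ξ))) :=
    ((Commute.refl _).smul_right t).exp_right
  rw [coe_adj, ← h.eq, mul_assoc, toMat_mul_inv, mul_one]

theorem exp_zsmul_mem_matrixSet {a : Matrix (Fin n) (Fin n) ℂ}
    (ha : NormedSpace.exp a ∈ matrixSet G) (k : ℤ) : NormedSpace.exp (k • a) ∈ matrixSet G := by
  have hneg : NormedSpace.exp (-a) ∈ matrixSet G := by
    obtain ⟨u, hu⟩ := ha
    rw [Matrix.exp_neg, ← hu]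
    exact ⟨u⁻¹, toMat_inv u⟩
  rcases Int.eq_nat_or_neg k with ⟨m, rfl | rfl⟩
  · rw [natCast_zsmul, Matrix.exp_nsmul]
    exact pow_mem_matrixSet G ha m
  · rw [neg_smul, natCast_zsmul, ← smul_neg, Matrix.exp_nsmul]
    exact pow_mem_matrixSet G hneg m

section
open scoped Matrix.Norms.Operator

/-- The Lie bracket of `G` in the coordinates `e`. -/
theorem exists_hasDerivAt_adj {V : Type*} [NormedAddCommGroup V] [NormedSpace ℝ V]
    (e : V ≃ₗ[ℝ] lieAlg G) :
    ∃ br : V →ₗ[ℝ] V →ₗ[ℝ] V, ∀ a b,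
      HasDerivAt (fun t : ℝ => e.symm (adj (expG (t • e a)) (e b))) (br a b) 0 := by
  obtain ⟨L, hL⟩ := LinearMap.exists_leftInverse_of_injective
    ((lieAlg G).subtype ∘ₗ e.toLinearMap)
    (LinearMap.ker_eq_bot.2 ((Submodule.injective_subtype _).comp e.injective))
  have hLe : ∀ ξ : lieAlg G, L ξ = e.symm ξ := fun ξ => by
    have := LinearMap.congr_fun hL (e.symm ξ)
    simpa using this
  refine ⟨LinearMap.mk₂ ℝ (fun a b => L ((e a : Matrix (Fin n) (Fin n) ℂ) * (e b) - e b * e a))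
    ?_ ?_ ?_ ?_, fun a b => ?_⟩
  · intro a b c
    rw [← map_add]; congr 1; simp only [map_add, Submodule.coe_add]; noncomm_ring
  · intro r a b
    rw [← map_smul]; congr 1
    simp only [map_smul, Submodule.coe_smul, smul_mul_assoc, mul_smul_comm, smul_sub]
  · intro a b c
    rw [← map_add]; congr 1; simp only [map_add, Submodule.coe_add]; noncomm_ring
  · intro r a b
    rw [← map_smul]; congr 1
    simp only [map_smul, Submodule.coe_smul, smul_mul_assoc, mul_smul_comm, smul_sub]
  · have h := hasDerivAt_exp_conj (A := Matrix (Fin n) (Fin n) ℂ) L (e a) (e b)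
    refine HasDerivAt.congr_deriv (h.congr_of_eventuallyEq (Eventually.of_forall fun t => ?_)) rfl
    simp only
    rw [← hLe, coe_adj, toMat_inv, toMat_expG, ← Matrix.exp_neg]
    rfl

/-- Closed subgroup theorem: near `1` the group `G` is the image of the exponential map. -/
theorem eventually_exists_expG_eq {V : Type*} [NormedAddCommGroup V] [NormedSpace ℝ V]
    (e : V ≃ₗ[ℝ] lieAlg G) {ε : ℝ} (hε : 0 < ε) :
    ∀ᶠ u in 𝓝 (1 : G), ∃ a : V, ‖a‖ < ε ∧ expG (e a) = u := by
  obtain ⟨L, hL⟩ := LinearMap.exists_leftInverse_of_injective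
    ((lieAlg G).subtype ∘ₗ e.toLinearMap)
    (LinearMap.ker_eq_bot.2 ((Submodule.injective_subtype _).comp e.injective))
  have h := eventually_exists_exp_eq (A := Matrix (Fin n) (Fin n) ℂ) (isClosed_matrixSet G)
    (fun a ha b hb => mul_mem_matrixSet G ha hb) (fun a ha k => exp_zsmul_mem_matrixSet ha k)
    (LinearMap.congr_fun hL) (fun a => exp_mem_matrixSet (e a))
    (fun w hw => ⟨e.symm ⟨w, hw⟩, by simp⟩) hε
  have hc : Continuous (toMat : G → Matrix (Fin n) (Fin n) ℂ) :=
    continuous_subtype_val.comp continuous_subtype_val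
  have h1 : Tendsto toMat (𝓝 (1 : G)) (𝓝 1) := hc.tendsto 1
  filter_upwards [h1.eventually h] with u hu
  obtain ⟨a, ha, h⟩ := hu ⟨u, rfl⟩
  exact ⟨a, ha, toMat_injective h⟩

end

instance compactSpace_unitaryGroup : CompactSpace (Matrix.unitaryGroup (Fin n) ℂ) := by
  refine isCompact_iff_compactSpace.1 ?_
  have h : IsCompact (Set.pi univ fun _ : Fin n => Set.pi univ fun _ : Fin n =>
      closedBall (0 : ℂ) 1) :=
    isCompact_univ_pi fun _ => isCompact_univ_pi fun _ => isCompact_closedBall _ _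
  refine h.of_isClosed_subset (isClosed_unitary (R := Matrix (Fin n) (Fin n) ℂ))
    fun U hU i _ j _ => ?_
  simpa using entry_norm_bound_of_unitary hU i j

end Group

/-! ### The vector fields of a local action -/

section LocalAction

variable {V₀ E : Type*} [NormedAddCommGroup V₀] [NormedSpace ℝ V₀]

section Real

variable [NormedAddCommGroup E] [NormedSpace ℝ E]

/-- The infinitesimal generators of a local action `ψ : V₀ × E → E`. -/
noncomputable def generator (ψ : V₀ × E → E) (z : E) : V₀ →L[ℝ] E :=
  (fderiv ℝ ψ (0, z)).comp (ContinuousLinearMap.inl ℝ V₀ E)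

variable {ψ : V₀ × E → E} {y : E}

theorem contDiffAt_generator (hψ : ContDiffAt ℝ ∞ ψ (0, y)) :
    ContDiffAt ℝ ∞ (generator ψ) y := by
  have h1 : ContDiffAt ℝ ∞ (fderiv ℝ ψ) (0, y) := hψ.fderiv_right (by norm_cast)
  have h2 : ContDiffAt ℝ ∞ (fun z => fderiv ℝ ψ (0, z)) y :=
    h1.comp y (contDiffAt_const.prodMk contDiffAt_id)
  exact h2.clm_comp contDiffAt_const

/-- The mixed second derivative of the action is symmetric, so differentiating the generator in
space equals differentiating the spatial differential along the group. -/
theorem fderiv_generator (hψ : ContDiffAt ℝ ∞ ψ (0, y)) (w : E) (a : V₀) :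
    fderiv ℝ (generator ψ) y w a = fderiv ℝ (fderiv ℝ ψ) (0, y) (a, 0) (0, w) := by
  have h1 : ContDiffAt ℝ ∞ (fderiv ℝ ψ) (0, y) := hψ.fderiv_right (by norm_cast)
  have h2 : HasFDerivAt (fun z => generator ψ z a)
      (((fderiv ℝ (fderiv ℝ ψ) (0, y)).comp (ContinuousLinearMap.inr ℝ V₀ E)).flip (a, 0)) y := by
    have h3 : HasFDerivAt (fun z : E => ((0 : V₀), z)) (ContinuousLinearMap.inr ℝ V₀ E) y :=
      (hasFDerivAt_const _ _).prodMk (hasFDerivAt_id _)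
    have h4 := ((h1.differentiableAt (by simp)).hasFDerivAt.comp y h3).clm_apply
      (hasFDerivAt_const ((a, 0) : V₀ × E) y)
    simpa [generator] using h4
  have h5 : HasFDerivAt (fun z => generator ψ z a) ((fderiv ℝ (generator ψ) y).flip a) y := by
    have := ((contDiffAt_generator hψ).differentiableAt (by simp)).hasFDerivAt.clm_apply
      (hasFDerivAt_const a y)
    simpa using this
  have h6 := congrArg (fun l : E →L[ℝ] E => l w) (h5.unique h2)
  simp only [ContinuousLinearMap.flip_apply, ContinuousLinearMap.comp_apply,
    ContinuousLinearMap.inr_apply] at h6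
  rw [h6]
  have hsymm : IsSymmSndFDerivAt ℝ ψ (0, y) := hψ.isSymmSndFDerivAt (by simp; norm_cast)
  exact hsymm _ _

theorem hasDerivAt_smul_prodMk (z : E) (u : V₀) :
    HasDerivAt (fun t : ℝ => (t • u, z)) (u, (0 : E)) 0 := by
  have := ((hasDerivAt_id (0 : ℝ)).smul_const u).prodMk (hasDerivAt_const (0 : ℝ) z)
  exact this.congr_deriv (by rw [one_smul])

theorem hasDerivAt_fderiv_smul (hψ : ContDiffAt ℝ ∞ ψ (0, y)) (w : E) (a : V₀) :
    HasDerivAt (fun t : ℝ => fderiv ℝ ψ (t • a, y) (0, w)) (fderiv ℝ (generator ψ) y w a) 0 := by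
  rw [fderiv_generator hψ]
  have h1 : ContDiffAt ℝ ∞ (fderiv ℝ ψ) (0, y) := hψ.fderiv_right (by norm_cast)
  have h3 : HasFDerivAt (fderiv ℝ ψ) (fderiv ℝ (fderiv ℝ ψ) (0, y)) (0, y) :=
    (h1.differentiableAt (by simp)).hasFDerivAt
  have h4 : HasDerivAt (fun t : ℝ => fderiv ℝ ψ (t • a, y))
      (fderiv ℝ (fderiv ℝ ψ) (0, y) (a, 0)) 0 :=
    h3.comp_hasDerivAt_of_eq (0 : ℝ) (hasDerivAt_smul_prodMk y a) (by rw [zero_smul])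
  exact (ContinuousLinearMap.apply ℝ E ((0, w) : V₀ × E)).hasFDerivAt.comp_hasDerivAt (0 : ℝ) h4

/-- The commutator of the generators of a local action that is equivariant with respect to the
adjoint action. -/
theorem fderiv_generator_comm (hψ : ContDiffAt ℝ ∞ ψ (0, y)) (hψ0 : ∀ᶠ z in 𝓝 y, ψ (0, z) = z)
    {a b d : V₀} {Ad : ℝ → V₀} (hAd0 : Ad 0 = b) (hAd : HasDerivAt Ad d 0)
    (hcomm : ∀ᶠ t : ℝ in 𝓝 0, ∀ᶠ s : ℝ in 𝓝 0,
      ψ (t • a, ψ (s • b, y)) = ψ (s • Ad t, ψ (t • a, y))) :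
    fderiv ℝ (generator ψ) y (generator ψ y a) b + generator ψ y d =
      fderiv ℝ (generator ψ) y (generator ψ y b) a := by
  have hψy : ψ (0, y) = y := hψ0.self_of_nhds
  have horb : ∀ (z : E) (u : V₀), DifferentiableAt ℝ ψ (0, z) →
      HasDerivAt (fun t : ℝ => ψ (t • u, z)) (generator ψ z u) 0 := by
    intro z u hz
    exact hz.hasFDerivAt.comp_hasDerivAt_of_eq (0 : ℝ) (hasDerivAt_smul_prodMk z u)
      (by rw [zero_smul])
  have hdiff : ∀ᶠ p in 𝓝 ((0 : V₀), y), DifferentiableAt ℝ ψ p := by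
    filter_upwards [(hψ.of_le (m := 1) (by norm_cast)).eventually (by simp)] with p hp
    exact hp.differentiableAt (by simp)
  have hψa := horb y a (hψ.differentiableAt (by simp))
  have ht1 : Tendsto (fun t : ℝ => (t • a, y)) (𝓝 0) (𝓝 (0, y)) := by
    simpa using (hasDerivAt_smul_prodMk y a).continuousAt.tendsto
  have ht2 : Tendsto (fun t : ℝ => ((0 : V₀), ψ (t • a, y))) (𝓝 0) (𝓝 (0, y)) := by
    have := hψa.continuousAt.tendsto
    simp only [zero_smul, hψy] at this
    exact tendsto_const_nhds.prodMk_nhds this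
  -- The conjugation identity is differentiated in `s` at 0, for each small `t`. Differentiating the
  -- result in `t` at 0 gives the commutator.
  have hev : ∀ᶠ t : ℝ in 𝓝 0, fderiv ℝ ψ (t • a, y) (0, generator ψ y b) =
      generator ψ (ψ (t • a, y)) (Ad t) := by
    filter_upwards [hcomm, ht1.eventually hdiff, ht2.eventually hdiff] with t ht hd1 hd2
    have hb := horb y b (hψ.differentiableAt (by simp))
    have h1 : HasDerivAt (fun s : ℝ => ψ (t • a, ψ (s • b, y)))
        (fderiv ℝ ψ (t • a, y) (0, generator ψ y b)) 0 := by
      exact hd1.hasFDerivAt.comp_hasDerivAt_of_eq (0 : ℝ)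
        ((hasDerivAt_const (0 : ℝ) (t • a)).prodMk hb) (by rw [zero_smul, hψy])
    exact (h1.congr_of_eventuallyEq (ht.mono fun s hs => hs.symm)).unique (horb _ (Ad t) hd2)
  have hL := hasDerivAt_fderiv_smul hψ (generator ψ y b) a
  have hR : HasDerivAt (fun t : ℝ => generator ψ (ψ (t • a, y)) (Ad t))
      (fderiv ℝ (generator ψ) y (generator ψ y a) b + generator ψ y d) 0 := by
    have h1 : HasFDerivAt (generator ψ) (fderiv ℝ (generator ψ) y) y :=
      ((contDiffAt_generator hψ).differentiableAt (by simp)).hasFDerivAt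
    have h2 : HasDerivAt (fun t : ℝ => generator ψ (ψ (t • a, y)))
        (fderiv ℝ (generator ψ) y (generator ψ y a)) 0 :=
      h1.comp_hasDerivAt_of_eq (0 : ℝ) hψa (by rw [zero_smul, hψy])
    refine (h2.clm_apply hAd).congr_deriv ?_
    rw [zero_smul, hψy, hAd0]
  exact (hR.congr_of_eventuallyEq hev).unique hL

end Real

/-! ### Complexified generators and their commutators. -/

section Complex

variable [NormedAddCommGroup E] [NormedSpace ℂ E]

/-- Multiplication by `i`. -/
noncomputable def mulI (E : Type*) [NormedAddCommGroup E] [NormedSpace ℂ E] : E →L[ℝ] E :=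
  ((Complex.I • ContinuousLinearMap.id ℂ E : E →L[ℂ] E)).restrictScalars ℝ

theorem mulI_apply (w : E) : mulI E w = Complex.I • w := rfl

theorem mulI_mulI (w : E) : mulI E (mulI E w) = -w := by
  rw [mulI_apply, mulI_apply, smul_smul, Complex.I_mul_I, neg_one_smul]

/-- The complex-linear extension of `l : V₀ → E` to `V₀ × V₀`, the complexification of `V₀`. -/
noncomputable def cplxExtend : (V₀ →L[ℝ] E) →L[ℝ] (V₀ × V₀ →L[ℝ] E) :=
  (ContinuousLinearMap.compL ℝ (V₀ × V₀) V₀ E).flip (ContinuousLinearMap.fst ℝ V₀ V₀) +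
    ((ContinuousLinearMap.compL ℝ (V₀ × V₀) V₀ E).flip (ContinuousLinearMap.snd ℝ V₀ V₀)).comp
      (ContinuousLinearMap.compL ℝ V₀ E E (mulI E))

theorem cplxExtend_apply (l : V₀ →L[ℝ] E) (p : V₀ × V₀) :
    cplxExtend l p = l p.1 + mulI E (l p.2) := rfl

/-- The complex-bilinear extension of a real bilinear map. -/
def cplxBracket (br : V₀ →ₗ[ℝ] V₀ →ₗ[ℝ] V₀) : (V₀ × V₀) →ₗ[ℝ] (V₀ × V₀) →ₗ[ℝ] (V₀ × V₀) :=
  LinearMap.mk₂ ℝ (fun p q => (br p.1 q.1 - br p.2 q.2, br p.1 q.2 + br p.2 q.1))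
    (fun p p' q => by ext <;> simp <;> abel) (fun c p q => by ext <;> simp [smul_sub, smul_add])
    (fun p q q' => by ext <;> simp <;> abel) (fun c p q => by ext <;> simp [smul_sub, smul_add])

theorem cplxBracket_apply (br : V₀ →ₗ[ℝ] V₀ →ₗ[ℝ] V₀) (p q : V₀ × V₀) :
    cplxBracket br p q = (br p.1 q.1 - br p.2 q.2, br p.1 q.2 + br p.2 q.1) := rfl

/-- The maps `ψ (t • a, ·)` have complex-linear differentials at `y`; differentiating this in `t` at
0 shows that the generator has one too. -/
theorem fderiv_generator_mulI {ψ : V₀ × E → E} {y : E} (hψ : ContDiffAt ℝ ∞ ψ (0, y))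
    {a : V₀} (hhol : ∀ᶠ t : ℝ in 𝓝 0, ∀ w, fderiv ℝ ψ (t • a, y) (0, mulI E w) =
      mulI E (fderiv ℝ ψ (t • a, y) (0, w))) (w : E) :
    fderiv ℝ (generator ψ) y (mulI E w) a = mulI E (fderiv ℝ (generator ψ) y w a) := by
  have h1 := hasDerivAt_fderiv_smul hψ (mulI E w) a
  have h2 := (mulI E).hasFDerivAt.comp_hasDerivAt (0 : ℝ) (hasDerivAt_fderiv_smul hψ w a)
  exact h1.unique (h2.congr_of_eventuallyEq (hhol.mono fun t ht => ht w))

/-- Complex linearity of the derivative (`hI`) lets `i` be pulled out of both slots, so the real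
commutator identity extends complex-bilinearly. -/
theorem fderiv_cplxExtend_comm {f : E → V₀ →L[ℝ] E} {y : E} (hf : DifferentiableAt ℝ f y)
    {br : V₀ →ₗ[ℝ] V₀ →ₗ[ℝ] V₀}
    (hbr : ∀ a b, fderiv ℝ f y (f y a) b + f y (br a b) = fderiv ℝ f y (f y b) a)
    (hI : ∀ w a, fderiv ℝ f y (mulI E w) a = mulI E (fderiv ℝ f y w a)) (p q : V₀ × V₀) :
    fderiv ℝ (fun z => cplxExtend (f z)) y (cplxExtend (f y) p) q +
        cplxExtend (f y) (cplxBracket br p q) =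
      fderiv ℝ (fun z => cplxExtend (f z)) y (cplxExtend (f y) q) p := by
  have h : ∀ w, fderiv ℝ (fun z => cplxExtend (f z)) y w = cplxExtend (fderiv ℝ f y w) := fun w => by
    have := (cplxExtend (V₀ := V₀) (E := E)).hasFDerivAt.comp y hf.hasFDerivAt
    exact congrArg (fun l : E →L[ℝ] _ => l w) this.fderiv
  rw [h, h]
  simp only [cplxExtend_apply, cplxBracket_apply, map_add, map_sub, hI, mulI_mulI,
    add_apply]
  rw [← hbr p.1 q.1, ← hbr p.1 q.2, ← hbr p.2 q.1, ← hbr p.2 q.2]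
  simp only [map_add]
  abel

end Complex

end LocalAction

/-! ### The action in charts -/

section ComplexManifold

variable {E : Type*} [NormedAddCommGroup E] [NormedSpace ℂ E]
  {X : Type*} [TopologicalSpace X] [ChartedSpace E X]

theorem fderiv_real_mulI {f : E → E} {y : E} (hf : DifferentiableAt ℂ f y) (w : E) :
    fderiv ℝ f y (mulI E w) = mulI E (fderiv ℝ f y w) := by
  rw [hf.fderiv_restrictScalars ℝ, mulI_apply, mulI_apply]
  exact map_smul (fderiv ℂ f y) Complex.I w

variable [IsManifold 𝓘(ℂ, E) ω X]

theorem contDiffAt_complex_coordChange {c c' : X} {y : E} (hy : y ∈ (chartAt E c).target)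
    (hy' : (chartAt E c).symm y ∈ (chartAt E c').source) :
    ContDiffAt ℂ ω (coordChange E c c') y := by
  have h := contDiffOn_ext_coord_change (I := 𝓘(ℂ, E)) (n := ω) c' c
  have hs : ((extChartAt 𝓘(ℂ, E) c).symm ≫ extChartAt 𝓘(ℂ, E) c').source ∈ 𝓝 y := by
    simp only [mfld_simps]
    exact ((chartAt E c).isOpen_inter_preimage_symm (chartAt E c').open_source).mem_nhds
      ⟨hy, hy'⟩
  have := h.contDiffAt hs
  simpa only [mfld_simps] using! this

theorem isManifold_real : IsManifold 𝓘(ℝ, E) ∞ X := by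
  refine isManifold_of_contDiffOn _ _ _ fun c c' hc hc' => ?_
  have h := (mem_groupoid_of_pregroupoid.1
    (HasGroupoid.compatible (G := contDiffGroupoid ω 𝓘(ℂ, E)) hc hc')).1
  simp only [contDiffPregroupoid, mfld_simps] at h ⊢
  exact (h.restrict_scalars ℝ).of_le le_top

theorem chartDeriv_mulI {c x : X} (hc : x ∈ (chartAt E c).source) (w : E) :
    chartDeriv c x (mulI E w) = mulI E (chartDeriv c x w) := by
  refine fderiv_real_mulI ((contDiffAt_complex_coordChange (mem_chart_target E x)
    ?_).differentiableAt (by simp)) w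
  rwa [(chartAt E x).left_inv (mem_chart_source E x)]

end ComplexManifold

section ActionChart

variable {n : ℕ} {E : Type*} [NormedAddCommGroup E] [NormedSpace ℂ E]
  {X : Type*} {G : ClosedSubgroup (Matrix.unitaryGroup (Fin n) ℂ)} [MulAction G X]
  {k : ℕ} (e : (Fin k → ℝ) ≃ₗ[ℝ] lieAlg G)

/-- The action of `exp ξ`, where `ξ ∈ 𝔤` has coordinates `a`. -/
noncomputable def expAct (a : Fin k → ℝ) (x : X) : X := expG (e a) • x

theorem expAct_zero (x : X) : expAct e 0 x = x := by
  rw [expAct, map_zero, expG_zero, one_smul]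

theorem expAct_add_smul (s t : ℝ) (a : Fin k → ℝ) (x : X) :
    expAct e ((s + t) • a) x = expAct e (s • a) (expAct e (t • a) x) := by
  rw [expAct, expAct, expAct, map_smul, expG_add_smul, mul_smul, map_smul, map_smul]

theorem expAct_adj (t s : ℝ) (a b : Fin k → ℝ) (x : X) :
    expAct e (t • a) (expAct e (s • b) x) =
      expAct e (s • e.symm (adj (expG (t • e a)) (e b))) (expAct e (t • a) x) := by
  simp only [expAct, smul_smul, map_smul, LinearEquiv.apply_symm_apply]
  rw [← adj_smul, expG_adj, inv_mul_cancel_right]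

variable [TopologicalSpace X] [ChartedSpace E X] {Ω : KaehlerForm E X}

/-- The action of `exp ξ` in the chart around `c`. -/
noncomputable def localAct (c : X) (p : (Fin k → ℝ) × E) : E :=
  chartAt E c (expAct e p.1 ((chartAt E c).symm p.2))

theorem contMDiff_expAct (hG : IsKaehlerAction G Ω) :
    ContMDiff (𝓘(ℝ, Fin k → ℝ).prod 𝓘(ℝ, E)) 𝓘(ℝ, E) ∞
      (fun p : (Fin k → ℝ) × X => expAct e p.1 p.2) := by
  convert hG.smooth k (fun i => e (Pi.single i 1)) 1 using 2 with p
  rw [mul_one, expAct]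
  congr 2
  conv_lhs => rw [← Finset.univ_sum_single p.1]
  rw [map_sum]
  refine Finset.sum_congr rfl fun i _ => ?_
  rw [← map_smul, ← Pi.single_smul]
  simp

theorem continuous_expAct (hG : IsKaehlerAction G Ω) :
    Continuous (fun p : (Fin k → ℝ) × X => expAct e p.1 p.2) :=
  (contMDiff_expAct e hG).continuous

theorem continuous_expAct_smul (hG : IsKaehlerAction G Ω) (a : Fin k → ℝ) (x : X) :
    Continuous (fun t : ℝ => expAct e (t • a) x) :=
  (continuous_expAct e hG).comp ((continuous_id.smul continuous_const).prodMk continuous_const)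

/-- Smoothness of the action is given only in exponential coordinates. By the closed subgroup
theorem these cover a neighbourhood of 1 in `G`, and translation carries the argument to any `u`.
Compactness of the orbits follows. -/
theorem continuous_smul_left (e : (Fin k → ℝ) ≃ₗ[ℝ] lieAlg G) (hG : IsKaehlerAction G Ω) (x : X) :
    Continuous (fun u : G => u • x) := by
  refine continuous_iff_continuousAt.2 fun u N hN => ?_
  have h1 : ContinuousAt (fun a : Fin k → ℝ => expAct e a (u • x)) 0 :=
    ((continuous_expAct e hG).comp (continuous_id.prodMk continuous_const)).continuousAt
  have h2 : ∀ᶠ a : Fin k → ℝ in 𝓝 0, expAct e a (u • x) ∈ N :=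
    h1.eventually (by simpa only [expAct_zero] using! hN)
  obtain ⟨ε, hε, hN'⟩ := Metric.eventually_nhds_iff.1 h2
  have h3 : Tendsto (fun u' : G => u' * u⁻¹) (𝓝 u) (𝓝 1) := by
    have : Continuous fun u' : G => u' * u⁻¹ :=
      continuous_induced_rng.2 (continuous_subtype_val.mul continuous_const)
    simpa using this.tendsto u
  refine mem_map.2 ?_
  filter_upwards [h3.eventually (eventually_exists_expG_eq e hε)] with u' ⟨a, ha, hau⟩
  rw [mem_preimage]
  have h4 := hN' (y := a) (by rwa [dist_zero_right])
  rwa [expAct, hau, smul_smul, inv_mul_cancel_right] at h4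

theorem isCompact_orbit (e : (Fin k → ℝ) ≃ₗ[ℝ] lieAlg G) (hG : IsKaehlerAction G Ω) (x : X) :
    IsCompact (MulAction.orbit G x) :=
  isCompact_range (continuous_smul_left e hG x)

theorem eventually_expAct_mem_source (hG : IsKaehlerAction G Ω) {c : X} {y : E}
    (hy : y ∈ (chartAt E c).target) (a : Fin k → ℝ) :
    ∀ᶠ t : ℝ in 𝓝 0, expAct e (t • a) ((chartAt E c).symm y) ∈ (chartAt E c).source := by
  refine (continuous_expAct_smul e hG a _).continuousAt.eventually
    ((chartAt E c).open_source.mem_nhds ?_)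
  simp only [zero_smul, expAct_zero]
  exact (chartAt E c).map_target hy

variable [IsManifold 𝓘(ℂ, E) ω X]

theorem contDiffAt_localAct (hG : IsKaehlerAction G Ω) {c : X} {a : Fin k → ℝ} {y : E}
    (hy : y ∈ (chartAt E c).target)
    (hy' : expAct e a ((chartAt E c).symm y) ∈ (chartAt E c).source) :
    ContDiffAt ℝ ∞ (localAct e c) (a, y) := by
  have : IsManifold 𝓘(ℝ, E) ∞ X := isManifold_real
  have h1 : ContMDiffAt 𝓘(ℝ, E) 𝓘(ℝ, E) ∞ (chartAt E c)
      (expAct e a ((chartAt E c).symm y)) :=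
    (contMDiffOn_chart (I := 𝓘(ℝ, E)) (n := ∞) (x := c)).contMDiffAt
      ((chartAt E c).open_source.mem_nhds hy')
  have h2 : ContMDiffAt 𝓘(ℝ, E) 𝓘(ℝ, E) ∞ (chartAt E c).symm y :=
    (contMDiffOn_chart_symm (I := 𝓘(ℝ, E)) (n := ∞) (x := c)).contMDiffAt
      ((chartAt E c).open_target.mem_nhds hy)
  have h3 : ContMDiffAt (𝓘(ℝ, Fin k → ℝ).prod 𝓘(ℝ, E)) (𝓘(ℝ, Fin k → ℝ).prod 𝓘(ℝ, E)) ∞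
      (fun p : (Fin k → ℝ) × E => (p.1, (chartAt E c).symm p.2)) (a, y) :=
    contMDiffAt_fst.prodMk (ContMDiffAt.comp (a, y) h2 contMDiffAt_snd)
  have h4 : ContMDiffAt (𝓘(ℝ, Fin k → ℝ).prod 𝓘(ℝ, E)) 𝓘(ℝ, E) ∞ (localAct e c) (a, y) :=
    ContMDiffAt.comp (a, y) (g := chartAt E c)
      (f := fun p : (Fin k → ℝ) × E => expAct e p.1 ((chartAt E c).symm p.2)) h1
      (ContMDiffAt.comp (a, y) (g := fun p : (Fin k → ℝ) × X => expAct e p.1 p.2)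
        (contMDiff_expAct e hG).contMDiffAt h3)
  rw [← modelWithCornersSelf_prod, chartedSpaceSelf_prod] at h4
  exact contMDiffAt_iff_contDiffAt.1 h4

theorem fderiv_localAct_mulI (hG : IsKaehlerAction G Ω) {c : X} {a : Fin k → ℝ} {y : E}
    (hy : y ∈ (chartAt E c).target)
    (hy' : expAct e a ((chartAt E c).symm y) ∈ (chartAt E c).source) (w : E) :
    fderiv ℝ (localAct e c) (a, y) (0, mulI E w) =
      mulI E (fderiv ℝ (localAct e c) (a, y) (0, w)) := by
  have h1 : MDifferentiableAt 𝓘(ℂ, E) 𝓘(ℂ, E) (chartAt E c)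
      (expAct e a ((chartAt E c).symm y)) :=
    ((contMDiffOn_chart (I := 𝓘(ℂ, E)) (n := ω) (x := c)).contMDiffAt
      ((chartAt E c).open_source.mem_nhds hy')).mdifferentiableAt (by simp)
  have h2 : MDifferentiableAt 𝓘(ℂ, E) 𝓘(ℂ, E) (chartAt E c).symm y :=
    ((contMDiffOn_chart_symm (I := 𝓘(ℂ, E)) (n := ω) (x := c)).contMDiffAt
      ((chartAt E c).open_target.mem_nhds hy)).mdifferentiableAt (by simp)
  have h3 : MDifferentiableAt 𝓘(ℂ, E) 𝓘(ℂ, E) (fun z => localAct e c (a, z)) y :=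
    MDifferentiableAt.comp y (g := chartAt E c)
      (f := fun z => expAct e a ((chartAt E c).symm z)) h1
      (MDifferentiableAt.comp y (g := fun x : X => expG (e a) • x) (hG.holomorphic _ _) h2)
  have h4 : HasFDerivAt (fun z => localAct e c (a, z))
      ((fderiv ℝ (localAct e c) (a, y)).comp (ContinuousLinearMap.inr ℝ _ E)) y := by
    have h5 := ((contDiffAt_localAct e hG hy hy').differentiableAt (by simp)).hasFDerivAt
    exact HasFDerivAt.comp (g := localAct e c) y h5
      ((hasFDerivAt_const a y).prodMk (hasFDerivAt_id y))
  have h5 := fderiv_real_mulI (mdifferentiableAt_iff_differentiableAt.1 h3) w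
  rw [h4.fderiv] at h5
  exact h5

/-- The infinitesimal action at `x` in coordinates on `𝔤`. -/
noncomputable def infAct (x : X) : (Fin k → ℝ) →L[ℝ] E :=
  generator (localAct e x) (chartAt E x x)

theorem hasDerivAt_chart_expAct (hG : IsKaehlerAction G Ω) {c x : X}
    (hx : x ∈ (chartAt E c).source) (a : Fin k → ℝ) :
    HasDerivAt (fun t : ℝ => chartAt E c (expAct e (t • a) x))
      (generator (localAct e c) (chartAt E c x) a) 0 := by
  have hl := (chartAt E c).left_inv hx
  have h1 := ((contDiffAt_localAct e hG (a := 0) ((chartAt E c).map_source hx)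
    (by rwa [expAct_zero, hl])).differentiableAt (by simp)).hasFDerivAt
  have h2 : HasDerivAt (fun t : ℝ => localAct e c (t • a, chartAt E c x))
      (generator (localAct e c) (chartAt E c x) a) 0 :=
    h1.comp_hasDerivAt_of_eq (0 : ℝ) (hasDerivAt_smul_prodMk (chartAt E c x) a)
      (by rw [zero_smul])
  simpa only [localAct, hl] using h2

theorem hasVelocity_expAct_zero (hG : IsKaehlerAction G Ω) (a : Fin k → ℝ) (x : X) :
    HasVelocity (fun t : ℝ => expAct e (t • a) x) (infAct e x a : E) 0 := by
  refine ⟨(continuous_expAct_smul e hG a x).continuousAt, ?_⟩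
  have := hasDerivAt_chart_expAct e hG (mem_chart_source E x) a
  simpa only [zero_smul, expAct_zero] using! this

theorem hasVelocity_expAct (hG : IsKaehlerAction G Ω) (a : Fin k → ℝ) (x : X) (t : ℝ) :
    HasVelocity (fun t : ℝ => expAct e (t • a) x) (infAct e (expAct e (t • a) x) a : E) t := by
  have h := hasVelocity_expAct_zero e hG a (expAct e (t • a) x)
  have h1 : HasDerivAt (fun s : ℝ => s - t) 1 t := (hasDerivAt_id t).sub_const t
  rw [← sub_self t] at h
  have h2 := HasVelocity.comp (f := fun s : ℝ => s - t) h h1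
  rw [one_smul] at h2
  refine h2.congr_of_eventuallyEq (Eventually.of_forall fun s => ?_)
  simp only
  rw [← expAct_add_smul, sub_add_cancel]

theorem infAction_eq (hG : IsKaehlerAction G Ω) (a : Fin k → ℝ) (x : X) :
    infAction E (e a) x = (infAct e x a : E) := by
  have h := (hasVelocity_iff_hasMFDerivAt.1 (hasVelocity_expAct_zero (E := E) e hG a x)).mfderiv
  have h2 : (fun t : ℝ => expG (t • e a) • x) = fun t : ℝ => expAct e (t • a) x := by
    funext t
    rw [expAct, map_smul]
  rw [infAction, h2]
  refine (congrArg (fun l : ℝ →L[ℝ] E => l 1) h).trans ?_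
  simp

theorem localField_infAct (hG : IsKaehlerAction G Ω) {c : X} {y : E}
    (hy : y ∈ (chartAt E c).target) :
    localField (infAct e) c y = generator (localAct e c) y := by
  have : IsManifold 𝓘(ℝ, E) ∞ X := isManifold_real
  ext1 a
  set x := (chartAt E c).symm y with hx
  have hxs : x ∈ (chartAt E c).source := (chartAt E c).map_target hy
  have h1 := hasDerivAt_chart_expAct e hG hxs a
  rw [hx, (chartAt E c).right_inv hy, ← hx] at h1
  have h2 := (hasVelocity_expAct_zero (E := E) e hG a x).hasDerivAt (c := c)
    (by rwa [zero_smul, expAct_zero])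
  rw [zero_smul, expAct_zero] at h2
  exact h2.unique h1

theorem localField_infAct_eventuallyEq (hG : IsKaehlerAction G Ω) {c : X} {y : E}
    (hy : y ∈ (chartAt E c).target) :
    localField (infAct e) c =ᶠ[𝓝 y] generator (localAct e c) := by
  filter_upwards [(chartAt E c).open_target.mem_nhds hy] with z hz using localField_infAct e hG hz

theorem contDiffAt_localAct_zero (hG : IsKaehlerAction G Ω) {c : X} {y : E}
    (hy : y ∈ (chartAt E c).target) : ContDiffAt ℝ ∞ (localAct e c) (0, y) :=
  contDiffAt_localAct e hG hy (by rw [expAct_zero]; exact (chartAt E c).map_target hy)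

theorem contDiffAt_localField_infAct (hG : IsKaehlerAction G Ω) {c : X} {y : E}
    (hy : y ∈ (chartAt E c).target) : ContDiffAt ℝ ∞ (localField (infAct e) c) y :=
  (contDiffAt_generator (contDiffAt_localAct_zero e hG hy)).congr_of_eventuallyEq
    (localField_infAct_eventuallyEq e hG hy)

theorem fderiv_localField_infAct_mulI (hG : IsKaehlerAction G Ω) {c : X} {y : E}
    (hy : y ∈ (chartAt E c).target) (w : E) (a : Fin k → ℝ) :
    fderiv ℝ (localField (infAct e) c) y (mulI E w) a =
      mulI E (fderiv ℝ (localField (infAct e) c) y w a) := by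
  rw [(localField_infAct_eventuallyEq e hG hy).fderiv_eq]
  exact fderiv_generator_mulI (contDiffAt_localAct_zero e hG hy)
    ((eventually_expAct_mem_source e hG hy a).mono fun t ht w =>
      fderiv_localAct_mulI e hG hy ht w) w

theorem fderiv_localField_infAct_comm (hG : IsKaehlerAction G Ω)
    {br : (Fin k → ℝ) →ₗ[ℝ] (Fin k → ℝ) →ₗ[ℝ] (Fin k → ℝ)}
    (hbr : ∀ a b, HasDerivAt (fun t : ℝ => e.symm (adj (expG (t • e a)) (e b))) (br a b) 0)
    {c : X} {y : E} (hy : y ∈ (chartAt E c).target) (a b : Fin k → ℝ) :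
    fderiv ℝ (localField (infAct e) c) y (localField (infAct e) c y a) b +
        localField (infAct e) c y (br a b) =
      fderiv ℝ (localField (infAct e) c) y (localField (infAct e) c y b) a := by
  rw [(localField_infAct_eventuallyEq e hG hy).fderiv_eq, localField_infAct e hG hy]
  refine fderiv_generator_comm (contDiffAt_localAct_zero e hG hy) ?_ ?_ (hbr a b) ?_
  · filter_upwards [(chartAt E c).open_target.mem_nhds hy] with z hz
    rw [localAct, expAct_zero, (chartAt E c).right_inv hz]
  · refine e.injective (Subtype.ext ?_)
    rw [zero_smul, expG_zero, LinearEquiv.apply_symm_apply, coe_adj]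
    simp [toMat_one]
  · filter_upwards [eventually_expAct_mem_source e hG hy a] with t ht
    filter_upwards [eventually_expAct_mem_source e hG hy b] with s hs
    simp only [localAct]
    rw [(chartAt E c).left_inv ht, (chartAt E c).left_inv hs, expAct_adj]

/-- The infinitesimal action `a + i b ↦ v_a + J v_b` of the complexified Lie algebra. -/
noncomputable def cplxInfAct (x : X) : (Fin k → ℝ) × (Fin k → ℝ) →L[ℝ] E :=
  cplxExtend (infAct e x)

theorem localField_cplxInfAct {c : X} {y : E} (hy : y ∈ (chartAt E c).target) :
    localField (cplxInfAct e) c y = cplxExtend (localField (infAct e) c y) := by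
  refine ContinuousLinearMap.ext fun p => ?_
  simp only [localField, cplxInfAct, ContinuousLinearMap.comp_apply, cplxExtend_apply, map_add]
  rw [chartDeriv_mulI ((chartAt E c).map_target hy)]

theorem contDiffOn_localField_cplxInfAct (hG : IsKaehlerAction G Ω) (c : X) :
    ContDiffOn ℝ ∞ (localField (cplxInfAct e) c) (chartAt E c).target := by
  intro y hy
  refine ContDiffWithinAt.congr (f := fun z => cplxExtend (localField (infAct e) c z)) ?_
    (fun z hz => localField_cplxInfAct e hz) (localField_cplxInfAct e hy)
  exact (cplxExtend.contDiff.contDiffAt.comp y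
    (contDiffAt_localField_infAct e hG hy)).contDiffWithinAt

theorem fderiv_localField_cplxInfAct_comm (hG : IsKaehlerAction G Ω)
    {br : (Fin k → ℝ) →ₗ[ℝ] (Fin k → ℝ) →ₗ[ℝ] (Fin k → ℝ)}
    (hbr : ∀ a b, HasDerivAt (fun t : ℝ => e.symm (adj (expG (t • e a)) (e b))) (br a b) 0)
    (c : X) (y : E) (hy : y ∈ (chartAt E c).target) (p q : (Fin k → ℝ) × (Fin k → ℝ)) :
    fderiv ℝ (localField (cplxInfAct e) c) y (localField (cplxInfAct e) c y p) q +
        localField (cplxInfAct e) c y (cplxBracket br p q) =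
      fderiv ℝ (localField (cplxInfAct e) c) y (localField (cplxInfAct e) c y q) p := by
  have h : localField (cplxInfAct e) c =ᶠ[𝓝 y]
      fun z => cplxExtend (localField (infAct e) c z) := by
    filter_upwards [(chartAt E c).open_target.mem_nhds hy] with z hz
      using localField_cplxInfAct e hz
  rw [h.fderiv_eq, localField_cplxInfAct e hy]
  exact fderiv_cplxExtend_comm ((contDiffAt_localField_infAct e hG hy).differentiableAt (by simp))
    (fderiv_localField_infAct_comm e hG hbr hy) (fderiv_localField_infAct_mulI e hG hy) p q

end ActionChart

/-! ### Linear differential equations -/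

section LinearODE

variable {W : Type*} [NormedAddCommGroup W] [NormedSpace ℝ W] [FiniteDimensional ℝ W]

/-- Injectivity in finite dimension makes `P 0` invertible, and `P q` stays invertible for `q` near
0. The curve solves p' = P(p)⁻¹ w, by Picard–Lindelöf. -/
theorem exists_curve_of_injective {P : W → W →L[ℝ] W} (hP : ContDiff ℝ ∞ P)
    (hinj : Function.Injective (P 0)) (w : W) :
    ∃ (p : ℝ → W) (ε : ℝ), 0 < ε ∧ p 0 = 0 ∧
      ∀ t ∈ Ioo (-ε) ε, ∃ p', HasDerivAt p p' t ∧ P (p t) p' = w := by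
  have : CompleteSpace W := FiniteDimensional.complete ℝ W
  obtain ⟨P₀, hP₀⟩ : ∃ P₀ : W ≃L[ℝ] W, (P₀ : W →L[ℝ] W) = P 0 :=
    ⟨(LinearEquiv.ofInjectiveEndo (P 0 : W →ₗ[ℝ] W) hinj).toContinuousLinearEquiv, by ext; rfl⟩
  have h1 : ContDiffAt ℝ 1 (fun p => ContinuousLinearMap.inverse (P p) w) 0 := by
    have h2 : ContDiffAt ℝ 1 ContinuousLinearMap.inverse (P 0) := by
      rw [← hP₀]; exact contDiffAt_map_inverse P₀
    exact (h2.comp (0 : W) (hP.contDiffAt.of_le (by norm_cast))).clm_apply contDiffAt_const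
  obtain ⟨p, hp0, ε, hε, hp⟩ :=
    h1.exists_forall_mem_closedBall_exists_eq_forall_mem_Ioo_hasDerivAt₀ 0
  simp only [zero_sub, zero_add] at hp
  have h3 : ∀ᶠ q in 𝓝 (0 : W), P q ∈ range ((↑) : (W ≃L[ℝ] W) → W →L[ℝ] W) :=
    hP.continuous.continuousAt.eventually (ContinuousLinearEquiv.isOpen.mem_nhds ⟨P₀, hP₀⟩)
  have h4 : ContinuousAt p 0 := (hp 0 ⟨by linarith, hε⟩).continuousAt
  rw [← hp0] at h3
  obtain ⟨ε', hε', h5⟩ := Metric.eventually_nhds_iff.1 (h4.eventually h3)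
  refine ⟨p, min ε ε', lt_min hε hε', hp0, fun t ht => ?_⟩
  have ht1 : |t| < min ε ε' := abs_lt.2 ht
  refine ⟨_, hp t (abs_lt.1 (ht1.trans_le (min_le_left _ _))), ?_⟩
  obtain ⟨A, hA⟩ := h5 (y := t) (by
    rw [Real.dist_eq, sub_zero]; exact ht1.trans_le (min_le_right _ _))
  rw [← hA, ContinuousLinearMap.inverse_equiv]
  exact A.apply_symm_apply w

/-- The operator `(κ, w) ↦ (A κ + w, 0)`. -/
noncomputable def augmented (A : W →L[ℝ] W) : W × W →L[ℝ] W × W :=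
  (ContinuousLinearMap.inl ℝ W W).comp
    (A.comp (ContinuousLinearMap.fst ℝ W W) + ContinuousLinearMap.snd ℝ W W)

/-- The value at time one of the solution of `κ' = A κ + w` as a function of `(κ 0, w)`. -/
noncomputable def affineSol (A : W →L[ℝ] W) : W × W →L[ℝ] W :=
  (ContinuousLinearMap.fst ℝ W W).comp (NormedSpace.exp (augmented A))

theorem contDiff_affineSol : ContDiff ℝ ∞ (affineSol (W := W)) := by
  have : CompleteSpace W := FiniteDimensional.complete ℝ W
  have h1 : ContDiff ℝ ∞ (augmented (W := W)) :=
    contDiff_const.clm_comp ((contDiff_id.clm_comp contDiff_const).add contDiff_const)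
  have h2 : ContDiff ℝ ∞ (NormedSpace.exp : (W × W →L[ℝ] W × W) → _) :=
    contDiff_iff_contDiffAt.2 fun x => (NormedSpace.exp_analytic (𝕂 := ℝ) x).contDiffAt
  exact contDiff_const.clm_comp (h2.comp h1)

theorem exists_affineSol (A : W →L[ℝ] W) (κ₀ w : W) :
    ∃ κ : ℝ → W, κ 0 = κ₀ ∧ κ 1 = affineSol A (κ₀, w) ∧ ∀ s, HasDerivAt κ (A (κ s) + w) s := by
  have : CompleteSpace W := FiniteDimensional.complete ℝ W
  set g : ℝ → W × W := fun s => NormedSpace.exp (s • augmented A) (κ₀, w) with hg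
  have h1 : ∀ s, HasDerivAt g (augmented A (g s)) s := fun s =>
    (ContinuousLinearMap.apply ℝ (W × W) ((κ₀, w) : W × W)).hasFDerivAt.comp_hasDerivAt s
      (hasDerivAt_exp_smul_const' (augmented A) s)
  have h0 : g 0 = (κ₀, w) := by simp [hg]
  have h2 : ∀ s, (g s).2 = w := fun s => by
    have h3 : ∀ s, HasDerivAt (fun s => (g s).2) 0 s := fun s =>
      (ContinuousLinearMap.snd ℝ W W).hasFDerivAt.comp_hasDerivAt s (h1 s)
    rw [is_const_of_deriv_eq_zero (fun s => (h3 s).differentiableAt) (fun s => (h3 s).deriv) s 0,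
      h0]
  refine ⟨fun s => (g s).1, by simp [h0], by simp [hg, affineSol], fun s => ?_⟩
  have h4 := (ContinuousLinearMap.fst ℝ W W).hasFDerivAt.comp_hasDerivAt s (h1 s)
  refine h4.congr_deriv ?_
  simp [augmented, h2]

theorem affineSol_zero (κ₀ w : W) : affineSol (0 : W →L[ℝ] W) (κ₀, w) = κ₀ + w := by
  obtain ⟨κ, h0, h1, hκ⟩ := exists_affineSol (0 : W →L[ℝ] W) κ₀ w
  have h2 : ∀ s, HasDerivAt (fun s : ℝ => κ s - s • w) 0 s := fun s => by
    have := (hκ s).sub ((hasDerivAt_id s).smul_const w)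
    exact this.congr_deriv (by simp)
  have h3 := is_const_of_deriv_eq_zero (fun s => (h2 s).differentiableAt)
    (fun s => (h2 s).deriv) 1 0
  simp only [one_smul, zero_smul, sub_zero, h0, h1] at h3
  exact sub_eq_iff_eq_add.1 h3

end LinearODE

/-! ### The linear equations of the complexified Lie algebra -/

section Bracket

variable {V₀ : Type*} [NormedAddCommGroup V₀] [NormedSpace ℝ V₀] [FiniteDimensional ℝ V₀]
  {br : V₀ →ₗ[ℝ] V₀ →ₗ[ℝ] V₀} {bf : V₀ →ₗ[ℝ] V₀ →ₗ[ℝ] ℝ}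

theorem hasDerivAt_bilin (bf : V₀ →ₗ[ℝ] V₀ →ₗ[ℝ] ℝ) {f g : ℝ → V₀} {f' g' : V₀} {t : ℝ}
    (hf : HasDerivAt f f' t) (hg : HasDerivAt g g' t) :
    HasDerivAt (fun s => bf (f s) (g s)) (bf (f t) g' + bf f' (g t)) t := by
  have := (bf.toContinuousBilinearMap.hasFDerivAt.comp_hasDerivAt t hf).clm_apply hg
  exact this.congr_deriv (by simp [add_comm])

/-- The derivative of ⟨Im κ, η⟩ is ⟨[η, Re κ] + w, η⟩. Skewness moves the bracket onto [η, η] = 0,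
leaving the constant ⟨w, η⟩. -/
theorem form_sub_eq (hskew : ∀ a b c, bf (br a b) c = -bf b (br a c)) {η : V₀} (hη : br η η = 0)
    {w : V₀} {κ : ℝ → V₀ × V₀} (hκ : ∀ s, HasDerivAt κ (cplxBracket br (0, η) (κ s) + (0, w)) s) :
    bf (κ 1).2 η - bf (κ 0).2 η = bf w η := by
  have h1 : ∀ s, HasDerivAt (fun s : ℝ => bf (κ s).2 η - s • bf w η) 0 s := fun s => by
    have h2 := (ContinuousLinearMap.snd ℝ V₀ V₀).hasFDerivAt.comp_hasDerivAt s (hκ s)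
    have h3 := (hasDerivAt_bilin bf h2 (hasDerivAt_const s η)).sub
      ((hasDerivAt_id s).smul_const (bf w η))
    refine h3.congr_deriv ?_
    simp [cplxBracket_apply, hskew, hη]
  have h4 := is_const_of_deriv_eq_zero (fun s => (h1 s).differentiableAt)
    (fun s => (h1 s).deriv) 1 0
  simp only [one_smul, zero_smul, sub_zero] at h4
  linarith

/-- Uniqueness for the linearised polar decomposition. -/
theorem eq_zero_of_boundary (hskew : ∀ a b c, bf (br a b) c = -bf b (br a c))
    (hpos : ∀ a, a ≠ 0 → 0 < bf a a) {η w v : V₀} {κ : ℝ → V₀ × V₀}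
    (hκ : ∀ s, HasDerivAt κ (cplxBracket br (0, η) (κ s) + (0, w)) s) (h0 : κ 0 = (v, 0))
    (h1 : κ 1 = 0) : v = 0 ∧ w = 0 := by
  have hnonneg : ∀ a, 0 ≤ bf a a := fun a => by
    rcases eq_or_ne a 0 with rfl | ha
    · simp
    · exact (hpos a ha).le
  have hdef : ∀ a, bf a a = 0 → a = 0 := fun a ha => by
    by_contra h
    exact (hpos a h).ne' ha
  have ha : ∀ s, HasDerivAt (fun s => (κ s).1) (-br η (κ s).2) s := fun s =>
    ((ContinuousLinearMap.fst ℝ V₀ V₀).hasFDerivAt.comp_hasDerivAt s (hκ s)).congr_deriv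
      (by simp [cplxBracket_apply])
  have hb : ∀ s, HasDerivAt (fun s => (κ s).2) (br η (κ s).1 + w) s := fun s =>
    ((ContinuousLinearMap.snd ℝ V₀ V₀).hasFDerivAt.comp_hasDerivAt s (hκ s)).congr_deriv
      (by simp [cplxBracket_apply])
  have hb' : ∀ s, HasDerivAt (fun s => br η (κ s).1 + w) (-br η (br η (κ s).2)) s := fun s =>
    (((br η).toContinuousLinearMap.hasFDerivAt.comp_hasDerivAt s (ha s)).add_const w).congr_deriv
      (by simp)
  -- With κ = a + ib, one has a' = −[η, b] and b' = [η, a] + w. The function h = ⟨b, b'⟩ satisfies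
  -- h' = |[η, b]|² + |b'|² ≥ 0 and vanishes at both ends, so both squares vanish on (0, 1). Then a
  -- is constant, equal to v = a(1) = 0, and w = b' − [η, a] = 0.
  set h : ℝ → ℝ := fun s => bf (κ s).2 (br η (κ s).1 + w) with hh
  have hd : ∀ s, HasDerivAt h (bf (br η (κ s).2) (br η (κ s).2) +
      bf (br η (κ s).1 + w) (br η (κ s).1 + w)) s := fun s =>
    (hasDerivAt_bilin bf (hb s) (hb' s)).congr_deriv (by
      rw [hskew η (κ s).2, map_neg])
  have hmono : Monotone h := monotone_of_deriv_nonneg (fun s => (hd s).differentiableAt) fun s => by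
    rw [(hd s).deriv]; exact add_nonneg (hnonneg _) (hnonneg _)
  have hh0 : h 0 = 0 := by simp [hh, h0]
  have hh1 : h 1 = 0 := by simp [hh, h1]
  have hz : ∀ s ∈ Ioo (0 : ℝ) 1, br η (κ s).2 = 0 ∧ br η (κ s).1 + w = 0 := fun s hs => by
    have h2 : h =ᶠ[𝓝 s] fun _ => 0 := by
      filter_upwards [isOpen_Ioo.mem_nhds hs] with t ht
      exact le_antisymm (hh1 ▸ hmono ht.2.le) (hh0 ▸ hmono ht.1.le)
    have h3 := (hd s).unique ((hasDerivAt_const s (0 : ℝ)).congr_of_eventuallyEq h2)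
    have h4 := hnonneg (br η (κ s).2)
    have h5 := hnonneg (br η (κ s).1 + w)
    exact ⟨hdef _ (by linarith), hdef _ (by linarith)⟩
  have hconst : ∀ s ∈ Icc (0 : ℝ) 1, (κ s).1 = v := by
    have := constant_of_has_deriv_right_zero (f := fun s => (κ s).1) (a := 0) (b := 1)
      (fun s _ => (ha s).continuousAt.continuousWithinAt) fun s hs => by
        have h2 : br η (κ s).2 = 0 := by
          rcases hs.1.eq_or_lt with h3 | h3
          · rw [← h3, h0]; simp
          · exact (hz s ⟨h3, hs.2⟩).1
        have := (ha s).hasDerivWithinAt (s := Ici s)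
        rwa [h2, neg_zero] at this
    simpa [h0] using this
  have hv : v = 0 := by
    rw [← hconst 1 (by simp), h1]; rfl
  refine ⟨hv, ?_⟩
  have h2 := (hz (1 / 2) (by norm_num)).2
  rwa [hconst (1 / 2) (by norm_num), hv, map_zero, zero_add] at h2

/-- An infinitesimal polar decomposition of exp(tw) exp(iη) as exp(i(η + β)) exp(α), with p = (α,
β). The solution `κ₁` computes the logarithmic derivative of exp(α), and `κ₂` carries it through the
second factor while adding the effect of β'. Requiring the result to be `w` is an ODE for p. -/
theorem exists_polar_curve (hskew : ∀ a b c, bf (br a b) c = -bf b (br a c))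
    (hpos : ∀ a, a ≠ 0 → 0 < bf a a) (η : V₀) (w : V₀ × V₀) :
    ∃ (p : ℝ → V₀ × V₀) (ε : ℝ), 0 < ε ∧ p 0 = 0 ∧ ∀ t ∈ Ioo (-ε) ε,
      ∃ (p' : V₀ × V₀) (κ₁ κ₂ : ℝ → V₀ × V₀), HasDerivAt p p' t ∧
        κ₁ 0 = 0 ∧ (∀ s, HasDerivAt κ₁ (cplxBracket br ((p t).1, 0) (κ₁ s) + (p'.1, 0)) s) ∧
        κ₂ 0 = κ₁ 1 ∧
        (∀ s, HasDerivAt κ₂ (cplxBracket br (0, η + (p t).2) (κ₂ s) + (0, p'.2)) s) ∧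
        κ₂ 1 = w ∧ (t = 0 → κ₁ 1 = (p'.1, 0)) := by
  set Br : (V₀ × V₀) →L[ℝ] (V₀ × V₀) →L[ℝ] (V₀ × V₀) :=
    (cplxBracket br).toContinuousBilinearMap with hBr
  have hBr' : ∀ p q, Br p q = cplxBracket br p q := fun p q => rfl
  let W := V₀ × V₀
  let A : W →L[ℝ] W × W := (ContinuousLinearMap.inr ℝ W W).comp
    ((ContinuousLinearMap.inl ℝ V₀ V₀).comp (ContinuousLinearMap.fst ℝ V₀ V₀))
  let B : W →L[ℝ] W × W := (ContinuousLinearMap.inr ℝ W W).comp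
    ((ContinuousLinearMap.inr ℝ V₀ V₀).comp (ContinuousLinearMap.snd ℝ V₀ V₀))
  let S₁ : W → W × W →L[ℝ] W := fun p => affineSol (Br (p.1, 0))
  let S₂ : W → W × W →L[ℝ] W := fun p => affineSol (Br (0, η + p.2))
  -- `P p` sends p' to the logarithmic derivative of exp(i(η + β)) exp(α). At `p = 0` its kernel is
  -- trivial by `eq_zero_of_boundary`.
  let P : W → W →L[ℝ] W := fun p =>
    (S₂ p).comp ((ContinuousLinearMap.inl ℝ W W).comp ((S₁ p).comp A) + B)
  have hPapply : ∀ p q : W, P p q = S₂ p (S₁ p (0, (q.1, 0)), (0, q.2)) := fun p q => by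
    change S₂ p (((S₁ p (0, (q.1, 0))), (0 : W)) + ((0 : W), ((0, q.2) : W))) = _
    rw [Prod.mk_add_mk, add_zero, zero_add]
  have hS₁ : ContDiff ℝ ∞ S₁ :=
    contDiff_affineSol.comp (Br.contDiff.comp (contDiff_fst.prodMk contDiff_const))
  have hS₂ : ContDiff ℝ ∞ S₂ :=
    contDiff_affineSol.comp
      (Br.contDiff.comp (contDiff_const.prodMk (contDiff_const.add contDiff_snd)))
  have hP : ContDiff ℝ ∞ P :=
    hS₂.clm_comp ((contDiff_const.clm_comp (hS₁.clm_comp contDiff_const)).add contDiff_const)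
  have hS₁0 : ∀ q : V₀, S₁ 0 (0, (q, 0)) = (q, 0) := fun q => by
    have h1 : Br ((0 : V₀), (0 : V₀)) = 0 := map_zero Br
    change affineSol (Br ((0 : V₀), (0 : V₀))) _ = _
    rw [h1, affineSol_zero, zero_add]
  have hinj : Function.Injective (P 0) := by
    refine (injective_iff_map_eq_zero (P 0)).2 fun q hq => ?_
    rw [hPapply, hS₁0] at hq
    obtain ⟨κ, h0, h1, hκ⟩ := exists_affineSol (Br (0, η + (0 : W).2)) (q.1, 0) (0, q.2)
    have h2 := eq_zero_of_boundary hskew hpos (by simpa [hBr'] using hκ) h0 (h1.trans hq)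
    exact Prod.ext h2.1 h2.2
  obtain ⟨p, ε, hε, hp0, hp⟩ := exists_curve_of_injective hP hinj w
  refine ⟨p, ε, hε, hp0, fun t ht => ?_⟩
  obtain ⟨p', hp', hPp⟩ := hp t ht
  obtain ⟨κ₁, h10, h11, hκ₁⟩ := exists_affineSol (Br ((p t).1, 0)) 0 (p'.1, 0)
  obtain ⟨κ₂, h20, h21, hκ₂⟩ := exists_affineSol (Br (0, η + (p t).2)) (κ₁ 1) (0, p'.2)
  refine ⟨p', κ₁, κ₂, hp', h10, hκ₁, h20, hκ₂, ?_, fun ht0 => ?_⟩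
  · rw [h21, h11, ← hPp, hPapply]
  · rw [h11, ht0, hp0]
    exact hS₁0 p'.1

end Bracket

/-! ### Shortening a polar decomposition -/

section Shortening

theorem IsFlow.zero_apply {E : Type*} [NormedAddCommGroup E] [NormedSpace ℝ E] [CompleteSpace E]
    {X : Type*} [TopologicalSpace X] [ChartedSpace E X] [IsManifold 𝓘(ℝ, E) ∞ X] [T2Space X]
    {W : Type*} [NormedAddCommGroup W] [NormedSpace ℝ W] {V : X → W →L[ℝ] E}
    {F : W → X → ℝ → X} (hF : IsFlow V F)
    (hV : ∀ c, ContDiffOn ℝ ∞ (localField V c) (chartAt E c).target) (y : X) (t : ℝ) :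
    F 0 y t = y :=
  congrFun (hF.eq_of_hasVelocity hV (ζ := 0) (γ := fun _ => y) fun t => by
    rw [map_zero]; exact hasVelocity_const y t) t

variable {V₀ : Type*} [NormedAddCommGroup V₀] [NormedSpace ℝ V₀] [FiniteDimensional ℝ V₀]
  {br : V₀ →ₗ[ℝ] V₀ →ₗ[ℝ] V₀} {bf : V₀ →ₗ[ℝ] V₀ →ₗ[ℝ] ℝ}
  {E : Type*} [NormedAddCommGroup E] [NormedSpace ℝ E] [FiniteDimensional ℝ E]
  {X : Type*} [TopologicalSpace X] [ChartedSpace E X] [IsManifold 𝓘(ℝ, E) ∞ X] [T2Space X]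
  {V : X → V₀ × V₀ →L[ℝ] E} {F : V₀ × V₀ → X → ℝ → X}

/-- The vector `w`, the transported `iξ₀` minus `iξ₁`, kills `x₁` and satisfies ⟨Im w, η⟩ < 0.
Moving the polar decomposition in the direction `w` therefore leaves the endpoint `x₁` in place and
decreases |η|² to first order. -/
theorem exists_shorter [CompactSpace X] (hF : IsFlow V F)
    (hV : ∀ c, ContDiffOn ℝ ∞ (localField V c) (chartAt E c).target)
    (hbr : ∀ c, ∀ y ∈ (chartAt E c).target, ∀ ζ κ,
      fderiv ℝ (localField V c) y (localField V c y ζ) κ +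
          localField V c y (cplxBracket br ζ κ) =
        fderiv ℝ (localField V c) y (localField V c y κ) ζ)
    (hsymm : ∀ a b, bf a b = bf b a) (hskew : ∀ a b c, bf (br a b) c = -bf b (br a c))
    (hpos : ∀ a, a ≠ 0 → 0 < bf a a) {η ξ₀ ξ₁ : V₀} (hη : br η η = 0) {y₀ x₁ : X}
    (h₁ : F (0, η) y₀ 1 = x₁) (hξ₀ : V y₀ (0, ξ₀) = 0) (hξ₁ : V x₁ (0, ξ₁) = 0)
    (hlt : bf ξ₀ η < bf ξ₁ η) :
    ∃ α η', bf η' η' < bf η η ∧ F (0, η') (F (α, 0) y₀ 1) 1 = x₁ := by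
  have := FiniteDimensional.complete ℝ E
  obtain ⟨κ', hκ0, -, hκ⟩ :=
    exists_affineSol ((cplxBracket br).toContinuousBilinearMap (0, η)) (0, ξ₀) 0
  replace hκ : ∀ s, HasDerivAt κ' (cplxBracket br (0, η) (κ' s) + (0, 0)) s := hκ
  -- The constant curve at `y₀` has velocity `V y₀ (0, ξ₀) = 0`. Its image under the time-one map is
  -- constant as well, and the first variation identifies the image's velocity as `V x₁ (κ' 1)`.
  have hVκ : V x₁ (κ' 1) = 0 := by
    have h2 := hF.hasVelocity_time_one hV hbr (hasDerivAt_const (0 : ℝ) ((0 : V₀), η)) hκ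
      (y := fun _ => y₀) (by rw [hκ0, hξ₀]; exact hasVelocity_const y₀ 0)
    simp only [h₁] at h2
    exact h2.unique (hasVelocity_const x₁ 0)
  set w : V₀ × V₀ := κ' 1 - (0, ξ₁) with hw
  have hVw : V x₁ w = 0 := by rw [hw, map_sub, hVκ, hξ₁, sub_zero]
  have hwη : bf w.2 η < 0 := by
    have h2 := form_sub_eq hskew hη hκ
    rw [hκ0] at h2
    simp only [hw, Prod.snd_sub, map_sub, LinearMap.sub_apply, map_zero,
      LinearMap.zero_apply] at h2 ⊢
    linarith
  obtain ⟨p, ε, hε, hp0, hp⟩ := exists_polar_curve hskew hpos η w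
  set x : ℝ → X := fun t => F (0, η + (p t).2) (F ((p t).1, 0) y₀ 1) 1 with hx
  have hx0 : x 0 = x₁ := by
    have h2 : F ((0 : V₀), (0 : V₀)) y₀ 1 = y₀ := hF.zero_apply hV y₀ 1
    simp only [hx, hp0, Prod.snd_zero, Prod.fst_zero, add_zero, h2, h₁]
  have hxv : ∀ t ∈ Ioo (-ε) ε, HasVelocity x (V (x t) w) t := fun t ht => by
    obtain ⟨p', κ₁, κ₂, hp', h10, hκ₁, h20, hκ₂, h21, -⟩ := hp t ht
    have hd1 : HasDerivAt (fun t => ((p t).1, (0 : V₀))) (p'.1, 0) t :=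
      ((ContinuousLinearMap.fst ℝ V₀ V₀).hasFDerivAt.comp_hasDerivAt t hp').prodMk
        (hasDerivAt_const t 0)
    have hd2 : HasDerivAt (fun t => ((0 : V₀), η + (p t).2)) (0, p'.2) t :=
      (hasDerivAt_const t 0).prodMk
        (((ContinuousLinearMap.snd ℝ V₀ V₀).hasFDerivAt.comp_hasDerivAt t hp').const_add η)
    have hv1 := hF.hasVelocity_time_one hV hbr hd1 hκ₁ (y := fun _ => y₀)
      (by rw [h10, map_zero]; exact hasVelocity_const y₀ t)
    rw [← h20] at hv1
    have hv2 := hF.hasVelocity_time_one hV hbr hd2 hκ₂ hv1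
    rwa [h21] at hv2
  have hε0 : (0 : ℝ) ∈ Ioo (-ε) ε := ⟨by linarith, hε⟩
  -- Both curves are integral curves of the field of `w`, which vanishes at `x₁`, so they agree by
  -- uniqueness.
  have hxeq : EqOn x (fun _ => x₁) (Ioo (-ε) ε) := eqOn_Ioo_of_hasVelocity hV hε0 hxv
    (fun t _ => by rw [hVw]; exact hasVelocity_const x₁ t) hx0
  obtain ⟨p', κ₁, κ₂, hp', -, -, h20, hκ₂, h21, h11⟩ := hp 0 hε0
  -- At `t = 0` the first factor contributes only the real vector `(p'.1, 0)`, so ⟨p'.2, η⟩ = ⟨w.2,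
  -- η⟩.
  have hp'η : bf p'.2 η < 0 := by
    rw [hp0, Prod.snd_zero, add_zero] at hκ₂
    have h2 := form_sub_eq hskew hη hκ₂
    rw [h21, h20, h11 rfl, map_zero, LinearMap.zero_apply, sub_zero] at h2
    rwa [← h2]
  have hd : HasDerivAt (fun t => bf (η + (p t).2) (η + (p t).2)) (bf η p'.2 + bf p'.2 η) 0 := by
    have h2 := ((ContinuousLinearMap.snd ℝ V₀ V₀).hasFDerivAt.comp_hasDerivAt 0 hp').const_add η
    refine (hasDerivAt_bilin bf h2 h2).congr_deriv ?_
    simp [hp0]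
  have hev := hd.tendsto_slope_zero_right.eventually (gt_mem_nhds (by
    rw [hsymm η]; linarith : bf η p'.2 + bf p'.2 η < 0))
  have hev2 : ∀ᶠ t : ℝ in 𝓝[>] 0, t ∈ Ioo 0 ε := Ioo_mem_nhdsGT hε
  obtain ⟨t, ht, ht'⟩ := (hev.and hev2).exists
  refine ⟨(p t).1, η + (p t).2, ?_, hxeq ⟨by linarith [ht'.1], ht'.2⟩⟩
  simp only [zero_add, hp0, Prod.snd_zero, add_zero, smul_eq_mul] at ht
  have := neg_of_mul_neg_right ht (inv_nonneg.2 ht'.1.le)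
  linarith

end Shortening

/-! ### Curves and differentials -/

section Curves

variable {E : Type*} [NormedAddCommGroup E] [NormedSpace ℝ E]
  {X : Type*} [TopologicalSpace X] [ChartedSpace E X]

theorem HasVelocity.hasDerivAt_comp {F : Type*} [NormedAddCommGroup F] [NormedSpace ℝ F]
    {γ : ℝ → X} {v : E} {t : ℝ} (h : HasVelocity γ v t) {f : X → F}
    (hf : MDifferentiableAt 𝓘(ℝ, E) 𝓘(ℝ, F) f (γ t)) :
    HasDerivAt (fun τ => f (γ τ)) (mfderiv 𝓘(ℝ, E) 𝓘(ℝ, F) f (γ t) v : F) t := by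
  have h1 := hf.hasMFDerivAt.comp t (hasVelocity_iff_hasMFDerivAt.1 h)
  let L : E →L[ℝ] F := mfderiv 𝓘(ℝ, E) 𝓘(ℝ, F) f (γ t)
  have h2 : HasFDerivAt (fun τ => f (γ τ)) (L.comp ((1 : ℝ →L[ℝ] ℝ).smulRight v)) t :=
    hasMFDerivAt_iff_hasFDerivAt.1 h1
  refine h2.hasDerivAt.congr_deriv ?_
  change L ((1 : ℝ) • v) = L v
  rw [one_smul]

theorem exists_hasVelocity [IsManifold 𝓘(ℝ, E) ∞ X] (x : X) (v : E) :
    ∃ γ : ℝ → X, γ 0 = x ∧ HasVelocity γ v 0 := by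
  have h0 : chartAt E x x + (0 : ℝ) • v = chartAt E x x := by simp
  refine ⟨fun t => (chartAt E x).symm (chartAt E x x + t • v), ?_, ?_⟩
  · simp only [h0]
    exact (chartAt E x).left_inv (mem_chart_source E x)
  · refine hasVelocity_chart_symm (α := fun t : ℝ => chartAt E x x + t • v)
      (by simp only [h0]; exact mem_chart_target E x) ?_
    simp only [h0, (chartAt E x).left_inv (mem_chart_source E x), chartDeriv_self]
    exact (((hasDerivAt_id (0 : ℝ)).smul_const v).const_add _).congr_deriv (one_smul ℝ v)

end Curves

/-! ### Sublevel sets of a positive definite form. -/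

section Form

variable {k : ℕ}

/-- The minimum of the form on the unit sphere bounds it below by a multiple of ‖a‖². An empty
sphere is possible only for `k = 0`. -/
theorem isCompact_form_le {bf : (Fin k → ℝ) →ₗ[ℝ] (Fin k → ℝ) →ₗ[ℝ] ℝ}
    (hpos : ∀ a, a ≠ 0 → 0 < bf a a) (R : ℝ) : IsCompact {a | bf a a ≤ R} := by
  have hcont : Continuous fun a => bf a a :=
    bf.toContinuousBilinearMap.continuous.clm_apply continuous_id
  have hbound : ∃ c > 0, ∀ a, c * ‖a‖ ^ 2 ≤ bf a a := by
    rcases (sphere (0 : Fin k → ℝ) 1).eq_empty_or_nonempty with hS | hS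
    · refine ⟨1, one_pos, fun a => ?_⟩
      rcases eq_or_ne a 0 with rfl | ha
      · simp
      · have : ‖a‖⁻¹ • a ∈ sphere (0 : Fin k → ℝ) 1 := by
          rw [mem_sphere_zero_iff_norm, norm_smul, norm_inv, norm_norm,
            inv_mul_cancel₀ (norm_ne_zero_iff.2 ha)]
        rw [hS] at this
        exact this.elim
    · obtain ⟨a₀, ha₀, hmin⟩ :=
        (isCompact_sphere (0 : Fin k → ℝ) 1).exists_isMinOn hS hcont.continuousOn
      refine ⟨bf a₀ a₀, hpos _ (ne_zero_of_mem_unit_sphere ⟨a₀, ha₀⟩), fun a => ?_⟩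
      rcases eq_or_ne a 0 with rfl | ha
      · simp
      · have hn : 0 < ‖a‖ := norm_pos_iff.2 ha
        have h1 : ‖a‖⁻¹ • a ∈ sphere (0 : Fin k → ℝ) 1 := by
          rw [mem_sphere_zero_iff_norm, norm_smul, norm_inv, norm_norm,
            inv_mul_cancel₀ (norm_ne_zero_iff.2 ha)]
        have h2 := isMinOn_iff.1 hmin _ h1
        simp only [map_smul, LinearMap.smul_apply, smul_eq_mul] at h2
        calc bf a₀ a₀ * ‖a‖ ^ 2 ≤ ‖a‖⁻¹ * (‖a‖⁻¹ * bf a a) * ‖a‖ ^ 2 := by gcongr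
          _ = bf a a := by field_simp
  obtain ⟨c, hc, hbound⟩ := hbound
  refine isCompact_of_isClosed_isBounded (isClosed_le hcont continuous_const) ?_
  refine (isBounded_iff_forall_norm_le).2 ⟨R / c + 1, fun a ha => ?_⟩
  have h1 : c * ‖a‖ ^ 2 ≤ R := (hbound a).trans ha
  have h2 : ‖a‖ ^ 2 ≤ R / c := by rw [le_div_iff₀ hc]; linarith
  nlinarith [sq_nonneg (‖a‖ - 1)]

end Form

/-! ### The moment map along curves -/

section Coordinates

variable {n k : ℕ} {G : ClosedSubgroup (Matrix.unitaryGroup (Fin n) ℂ)}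
  (e : (Fin k → ℝ) ≃ₗ[ℝ] lieAlg G) (B : InvariantInner G)

/-- The invariant inner product in coordinates on `𝔤`. -/
noncomputable def coordForm : (Fin k → ℝ) →ₗ[ℝ] (Fin k → ℝ) →ₗ[ℝ] ℝ :=
  B.form.compl₁₂ e.toLinearMap e.toLinearMap

theorem coordForm_apply (a b : Fin k → ℝ) : coordForm e B a b = B.form (e a) (e b) := rfl

theorem coordForm_symm (a b : Fin k → ℝ) : coordForm e B a b = coordForm e B b a :=
  B.symm _ _

theorem coordForm_pos (a : Fin k → ℝ) (ha : a ≠ 0) : 0 < coordForm e B a a :=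
  B.pos _ (by simpa using ha)

variable {e} {br : (Fin k → ℝ) →ₗ[ℝ] (Fin k → ℝ) →ₗ[ℝ] (Fin k → ℝ)}

theorem adj_expG_zero_smul (ξ ζ : lieAlg G) : adj (expG ((0 : ℝ) • ξ)) ζ = ζ := by
  refine Subtype.ext ?_
  rw [zero_smul, expG_zero, coe_adj]
  simp [toMat_one]

/-- Derivative at `t = 0` of the invariance of the inner product under Ad(exp(ta)). -/
theorem coordForm_bracket
    (hbr : ∀ a b, HasDerivAt (fun t : ℝ => e.symm (adj (expG (t • e a)) (e b))) (br a b) 0)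
    (a b c : Fin k → ℝ) : coordForm e B (br a b) c = -coordForm e B b (br a c) := by
  have h1 := hasDerivAt_bilin (coordForm e B) (hbr a b) (hbr a c)
  simp only [adj_expG_zero_smul, LinearEquiv.symm_apply_apply] at h1
  have h2 : ∀ t : ℝ, coordForm e B (e.symm (adj (expG (t • e a)) (e b)))
      (e.symm (adj (expG (t • e a)) (e c))) = coordForm e B b c := fun t => by
    simp only [coordForm_apply, LinearEquiv.apply_symm_apply, B.invariant]
  simp only [h2] at h1
  have h3 := h1.unique (hasDerivAt_const (0 : ℝ) (coordForm e B b c))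
  linarith

theorem bracket_self
    (hbr : ∀ a b, HasDerivAt (fun t : ℝ => e.symm (adj (expG (t • e a)) (e b))) (br a b) 0)
    (a : Fin k → ℝ) : br a a = 0 := by
  have h1 := hbr a a
  simp only [adj_expG_self, LinearEquiv.symm_apply_apply] at h1
  exact h1.unique (hasDerivAt_const (0 : ℝ) a)

end Coordinates

/-! ### Moment map, critical points and positivity. -/

section Moment

variable {n k : ℕ} {E : Type*} [NormedAddCommGroup E] [NormedSpace ℂ E]
  {X : Type*} [TopologicalSpace X] [ChartedSpace E X]
  {G : ClosedSubgroup (Matrix.unitaryGroup (Fin n) ℂ)}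

theorem KaehlerForm.eq_zero_of_nonpos (Ω : KaehlerForm E X) {x : X}
    {v : TangentSpace 𝓘(ℝ, E) x} (h : Ω.form x ![v, cplxJ v] ≤ 0) : v = 0 := by
  by_contra hv
  exact (Ω.pos x v hv).not_ge h

theorem KaehlerForm.nonneg (Ω : KaehlerForm E X) {x : X} (v : TangentSpace 𝓘(ℝ, E) x) :
    0 ≤ Ω.form x ![v, cplxJ v] := by
  rcases eq_or_ne v 0 with rfl | hv
  · exact ((Ω.form x).map_coord_zero (m := ![0, cplxJ 0]) 0 rfl).ge
  · exact (Ω.pos x v hv).le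

variable [MulAction G X] {Ω : KaehlerForm E X} {B : InvariantInner G} {μ : X → lieAlg G}
  (e : (Fin k → ℝ) ≃ₗ[ℝ] lieAlg G)

theorem IsMomentMap.hasDerivAt_form (hμ : IsMomentMap Ω B μ) {γ : ℝ → X} {t : ℝ}
    {v : TangentSpace 𝓘(ℝ, E) (γ t)} (hγ : HasVelocity (E := E) γ v t) (ξ : lieAlg G) :
    HasDerivAt (fun τ => B.form (μ (γ τ)) ξ) (Ω.form (γ t) ![infAction E ξ (γ t), v]) t := by
  rw [← hμ.hamiltonian]
  exact hγ.hasDerivAt_comp ((hμ.smooth ξ).mdifferentiableAt (by simp))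

/-- The moment map in coordinates on `𝔤` is smooth. -/
theorem IsMomentMap.contMDiff_symm (hμ : IsMomentMap Ω B μ) :
    ContMDiff 𝓘(ℝ, E) 𝓘(ℝ, Fin k → ℝ) ∞ (fun x => e.symm (μ x)) := by
  -- `T` is the Gram map of the inner product, invertible by positivity. The hypotheses give
  -- smoothness of `T ∘ μ` in coordinates, and inverting `T` gives that of `μ`.
  let T : (Fin k → ℝ) →ₗ[ℝ] (Fin k → ℝ) :=
    LinearMap.pi fun i => (coordForm e B).flip (Pi.single i 1)
  have hT : Function.Injective T := by
    refine (injective_iff_map_eq_zero T).2 fun a ha => ?_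
    have h : coordForm e B a = 0 := (Pi.basisFun ℝ (Fin k)).ext fun i => by
      simpa [T] using congrFun ha i
    by_contra ha
    exact (coordForm_pos e B a ha).ne' (by rw [h, LinearMap.zero_apply])
  let T' : (Fin k → ℝ) ≃L[ℝ] (Fin k → ℝ) :=
    (LinearEquiv.ofInjectiveEndo T hT).toContinuousLinearEquiv
  have h1 : ContMDiff 𝓘(ℝ, E) 𝓘(ℝ, Fin k → ℝ) ∞ (fun x => T (e.symm (μ x))) := by
    refine contMDiff_pi_space.2 fun i => ?_
    simpa [T, coordForm_apply] using! hμ.smooth (e (Pi.single i 1))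
  have h2 : (fun x => e.symm (μ x)) = fun x => T'.symm (T (e.symm (μ x))) := by
    funext x
    exact (T'.symm_apply_apply _).symm
  rw [h2]
  exact T'.symm.contDiff.contMDiff.comp h1

theorem IsMomentMap.hasDerivAt_momentSq (e : (Fin k → ℝ) ≃ₗ[ℝ] lieAlg G) (hμ : IsMomentMap Ω B μ) {γ : ℝ → X} {t : ℝ}
    {v : TangentSpace 𝓘(ℝ, E) (γ t)} (hγ : HasVelocity (E := E) γ v t) :
    HasDerivAt (fun τ => momentSq B μ (γ τ))
      (Ω.form (γ t) ![infAction E (μ (γ t)) (γ t), v]) t := by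
  have h1 := hγ.hasDerivAt_comp ((hμ.contMDiff_symm e).mdifferentiableAt (by simp))
  set m' : Fin k → ℝ :=
    (mfderiv 𝓘(ℝ, E) 𝓘(ℝ, Fin k → ℝ) (fun x => e.symm (μ x)) (γ t) v : Fin k → ℝ)
  have h2 := (hasDerivAt_bilin (coordForm e B) h1 h1).const_mul (1 / 2)
  have h3 := (hasDerivAt_bilin (coordForm e B) h1 (hasDerivAt_const t (e.symm (μ (γ t)))))
  simp only [coordForm_apply, LinearEquiv.apply_symm_apply, map_zero, zero_add] at h2 h3
  have h4 := h3.unique (hμ.hasDerivAt_form hγ (μ (γ t)))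
  refine h2.congr_deriv ?_
  rw [B.symm (μ (γ t)), h4]
  ring

/-- Since df(v) = Ω(v_μ, v), the choice v = J v_μ gives |v_μ|² = 0 at a critical point. -/
theorem IsMomentMap.infAction_eq_zero_of_isCritical (e : (Fin k → ℝ) ≃ₗ[ℝ] lieAlg G) [IsManifold 𝓘(ℝ, E) ∞ X]
    (hμ : IsMomentMap Ω B μ) {x : X} (hx : IsCritical E B μ x) :
    infAction E (μ x) x = 0 := by
  have hs : MDifferentiableAt 𝓘(ℝ, E) 𝓘(ℝ, ℝ) (momentSq B μ) x := by
    have h1 : ContDiff ℝ ∞ fun a => 1 / 2 * coordForm e B a a :=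
      contDiff_const.mul ((coordForm e B).toContinuousBilinearMap.contDiff.clm_apply contDiff_id)
    have h2 := (h1.contMDiff.comp (hμ.contMDiff_symm e)).mdifferentiable (by simp) x
    have h3 : momentSq B μ =
        fun x => 1 / 2 * coordForm e B (e.symm (μ x)) (e.symm (μ x)) := by
      funext y
      simp only [momentSq, coordForm_apply, LinearEquiv.apply_symm_apply]
    rw [h3]
    exact h2
  obtain ⟨γ, h0, hγ⟩ := exists_hasVelocity (E := E) x (cplxJ (infAction E (μ x) x))
  have h1 := hμ.hasDerivAt_momentSq e hγ
  have h2 := hγ.hasDerivAt_comp (f := momentSq B μ) (by rwa [h0])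
  have h3 := h1.unique h2
  rw [h0, hx] at h3
  exact Ω.eq_zero_of_nonpos h3.le

end Moment

/-! ### Uniqueness of critical points in an orbit of the complexified group -/

section Uniqueness

variable {n k : ℕ} {E : Type*} [NormedAddCommGroup E] [NormedSpace ℂ E]
  {X : Type*} [TopologicalSpace X] [ChartedSpace E X]
  {G : ClosedSubgroup (Matrix.unitaryGroup (Fin n) ℂ)} [MulAction G X]
  {Ω : KaehlerForm E X} {B : InvariantInner G} {μ : X → lieAlg G}
  (e : (Fin k → ℝ) ≃ₗ[ℝ] lieAlg G)

theorem cplxInfAct_fst (x : X) (a : Fin k → ℝ) :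
    (cplxInfAct e x (a, 0) : E) = infAct e x a := by
  rw [cplxInfAct, cplxExtend_apply, map_zero, map_zero, add_zero]

variable [IsManifold 𝓘(ℂ, E) ω X]

theorem cplxInfAct_snd (hG : IsKaehlerAction G Ω) (x : X) (b : Fin k → ℝ) :
    (cplxInfAct e x (0, b) : E) = cplxJ (infAction E (e b) x) := by
  rw [cplxInfAct, cplxExtend_apply, map_zero, zero_add, infAction_eq e hG]
  rfl

theorem cplxInfAct_snd_eq_zero (hG : IsKaehlerAction G Ω) {x : X} {b : Fin k → ℝ}
    (h : infAction E (e b) x = 0) : (cplxInfAct e x (0, b) : E) = 0 := by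
  rw [cplxInfAct_snd e hG, h]
  exact smul_zero (A := E) Complex.I

theorem hasVelocity_expAct_cplx (hG : IsKaehlerAction G Ω) (a : Fin k → ℝ) (x : X) (t : ℝ) :
    HasVelocity (fun t : ℝ => expAct e (t • a) x)
      (cplxInfAct e (expAct e (t • a) x) (a, 0) : E) t := by
  rw [cplxInfAct_fst]
  exact hasVelocity_expAct e hG a x t

variable [FiniteDimensional ℂ E] [T2Space X]

theorem IsFlow.expAct {F : (Fin k → ℝ) × (Fin k → ℝ) → X → ℝ → X} (hG : IsKaehlerAction G Ω)
    (hF : IsFlow (cplxInfAct (E := E) e) F) (a : Fin k → ℝ) (x : X) :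
    F (a, 0) x 1 = NessUniqueness.expAct e a x := by
  have : IsManifold 𝓘(ℝ, E) ∞ X := isManifold_real
  have : FiniteDimensional ℝ E := FiniteDimensional.complexToReal E
  have : CompleteSpace E := FiniteDimensional.complete ℝ E
  have h := hF.eq_of_hasVelocity (contDiffOn_localField_cplxInfAct e hG)
    (hasVelocity_expAct_cplx e hG a x)
  rw [zero_smul, expAct_zero] at h
  rw [h]
  simp only [one_smul]

/-- If `v_{μ(x)}` vanishes at `x`, then it vanishes on the orbit of `x`. -/
theorem IsMomentMap.infAction_smul_eq_zero (e : (Fin k → ℝ) ≃ₗ[ℝ] lieAlg G) (hG : IsKaehlerAction G Ω) (hμ : IsMomentMap Ω B μ)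
    {x : X} (h : infAction E (μ x) x = 0) (u : G) : infAction E (μ (u • x)) (u • x) = 0 := by
  have : IsManifold 𝓘(ℝ, E) ∞ X := isManifold_real
  have : FiniteDimensional ℝ E := FiniteDimensional.complexToReal E
  have : CompleteSpace E := FiniteDimensional.complete ℝ E
  set a := e.symm (μ x) with ha
  have hea : e a = μ x := e.apply_symm_apply _
  have h0 : (cplxInfAct e x (a, 0) : E) = 0 := by
    rw [cplxInfAct_fst, ← infAction_eq e hG, hea, h]
    rfl
  -- The field of `μ x` vanishes at `x`, so exp(tμ(x)) fixes `x`. By equivariance its conjugate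
  -- exp(tμ(ux)) fixes `u • x`.
  have h1 := eq_of_hasVelocity (contDiffOn_localField_cplxInfAct e hG)
    (hasVelocity_expAct_cplx e hG a x) (γ' := fun _ => x)
    (fun t => by rw [h0]; exact hasVelocity_const x t) (by rw [zero_smul, expAct_zero])
  have h2 : ∀ t : ℝ, expAct e (t • e.symm (μ (u • x))) (u • x) = u • x := fun t => by
    have h3 : expG (t • μ x) • x = x := by
      simpa only [expAct, map_smul, hea] using congrFun h1 t
    rw [expAct, map_smul, LinearEquiv.apply_symm_apply, hμ.equivariant, ← adj_smul, expG_adj,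
      mul_smul, mul_smul, inv_smul_smul, h3]
  have h4 := hasVelocity_expAct_zero (E := E) e hG (e.symm (μ (u • x))) (u • x)
  simp only [h2] at h4
  have h5 := h4.unique (hasVelocity_const (u • x) 0)
  rw [← infAction_eq e hG, LinearEquiv.apply_symm_apply] at h5
  exact h5

/-- The function `⟨μ, η⟩` increases along the nonconstant integral curves of `J v_η`. -/
theorem IsMomentMap.eq_of_form_le (hG : IsKaehlerAction G Ω) (hμ : IsMomentMap Ω B μ)
    {γ : ℝ → X} {η : Fin k → ℝ} (hγ : ∀ t, HasVelocity γ (cplxInfAct e (γ t) (0, η) : E) t)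
    (h : B.form (μ (γ 1)) (e η) ≤ B.form (μ (γ 0)) (e η)) : γ 1 = γ 0 := by
  have : IsManifold 𝓘(ℝ, E) ∞ X := isManifold_real
  have : FiniteDimensional ℝ E := FiniteDimensional.complexToReal E
  have : CompleteSpace E := FiniteDimensional.complete ℝ E
  set f : ℝ → ℝ := fun t => B.form (μ (γ t)) (e η) with hf
  have hd : ∀ t, HasDerivAt f (Ω.form (γ t) ![infAction E (e η) (γ t),
      cplxJ (infAction E (e η) (γ t))]) t := fun t => by
    have h1 := hγ t
    rw [cplxInfAct_snd e hG] at h1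
    exact hμ.hasDerivAt_form h1 (e η)
  have hmono : Monotone f := monotone_of_deriv_nonneg (fun s => (hd s).differentiableAt) fun s => by
    rw [(hd s).deriv]; exact Ω.nonneg _
  -- A monotone function that does not increase from 0 to 1 is constant there, so its derivative
  -- |v_η|² vanishes at the interior time 1/2. An integral curve through a zero of the field is
  -- constant.
  have h2 : f =ᶠ[𝓝 (1 / 2)] fun _ => f 0 := by
    filter_upwards [isOpen_Ioo.mem_nhds (by norm_num : (1 / 2 : ℝ) ∈ Ioo 0 1)] with t ht
    exact le_antisymm ((hmono ht.2.le).trans h) (hmono ht.1.le)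
  have h3 := (hd (1 / 2)).unique ((hasDerivAt_const (1 / 2) (f 0)).congr_of_eventuallyEq h2)
  have h4 := cplxInfAct_snd_eq_zero e hG (Ω.eq_zero_of_nonpos h3.le)
  have h5 := eqOn_Ioo_of_hasVelocity (contDiffOn_localField_cplxInfAct e hG)
    (by norm_num : (1 / 2 : ℝ) ∈ Ioo (-1) 2) (γ' := fun _ => γ (1 / 2)) (fun t _ => hγ t)
    (fun t _ => by rw [h4]; exact hasVelocity_const _ t) rfl
  rw [h5 (by norm_num : (1 : ℝ) ∈ Ioo (-1) 2), h5 (by norm_num : (0 : ℝ) ∈ Ioo (-1) 2)]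

/-- The variational argument: minimise |η|² over all ways of reaching `x₁` from the orbit. The bound
by the initial `η₀` makes this set of pairs compact. -/
theorem mem_orbit_of_flow [CompactSpace X] (hG : IsKaehlerAction G Ω) (hμ : IsMomentMap Ω B μ)
    {F : (Fin k → ℝ) × (Fin k → ℝ) → X → ℝ → X} (hF : IsFlow (cplxInfAct (E := E) e) F)
    {x₀ x₁ : X} (h₀ : infAction E (μ x₀) x₀ = 0) (h₁ : infAction E (μ x₁) x₁ = 0)
    {u₀ : G} {η₀ : Fin k → ℝ} (h : F (0, η₀) (u₀ • x₀) 1 = x₁) : x₁ ∈ MulAction.orbit G x₀ := by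
  have : IsManifold 𝓘(ℝ, E) ∞ X := isManifold_real
  have : FiniteDimensional ℝ E := FiniteDimensional.complexToReal E
  have : CompleteSpace E := FiniteDimensional.complete ℝ E
  have hV := contDiffOn_localField_cplxInfAct (X := X) (Ω := Ω) e hG
  obtain ⟨br, hbr⟩ := exists_hasDerivAt_adj e
  let bf := coordForm e B
  let S : Set ((Fin k → ℝ) × X) :=
    ({a | bf a a ≤ bf η₀ η₀} ×ˢ MulAction.orbit G x₀) ∩ {p | F (0, p.1) p.2 1 = x₁}
  have hFc : Continuous fun p : (Fin k → ℝ) × X => F (0, p.1) p.2 1 :=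
    (hF.continuous_time_one hV).comp
      ((continuous_const.prodMk continuous_fst).prodMk continuous_snd)
  have hS : IsCompact S :=
    ((isCompact_form_le (coordForm_pos e B) _).prod (isCompact_orbit e hG x₀)).inter_right
      (isClosed_eq hFc continuous_const)
  have hqc : Continuous fun p : (Fin k → ℝ) × X => bf p.1 p.1 :=
    (bf.toContinuousBilinearMap.continuous.comp continuous_fst).clm_apply continuous_fst
  obtain ⟨⟨η, y⟩, ⟨⟨hηle, hy⟩, hηy⟩, hmin⟩ :=
    hS.exists_isMinOn ⟨(η₀, u₀ • x₀), ⟨le_refl (bf η₀ η₀), u₀, rfl⟩, h⟩ hqc.continuousOn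
  simp only [mem_ofPred_eq] at hηle hηy
  have hy0 : infAction E (μ y) y = 0 := by
    obtain ⟨u, rfl⟩ := hy
    exact hμ.infAction_smul_eq_zero e hG h₀ u
  by_cases hle : B.form (μ x₁) (e η) ≤ B.form (μ y) (e η)
  · have hγ := hF (0, η) y
    have h2 := hμ.eq_of_form_le e hG hγ.2 (by rwa [hηy, hγ.1])
    rw [hηy, hγ.1] at h2
    rwa [h2]
  · exfalso
    obtain ⟨α, η', hlt, hη'⟩ := exists_shorter (bf := bf) hF hV
      (fderiv_localField_cplxInfAct_comm e hG hbr) (coordForm_symm e B)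
      (coordForm_bracket B hbr) (coordForm_pos e B) (ξ₀ := e.symm (μ y)) (ξ₁ := e.symm (μ x₁))
      (bracket_self hbr η) hηy
      (cplxInfAct_snd_eq_zero e hG (by rwa [LinearEquiv.apply_symm_apply]))
      (cplxInfAct_snd_eq_zero e hG (by rwa [LinearEquiv.apply_symm_apply]))
      (by
        simp only [bf, coordForm_apply, LinearEquiv.apply_symm_apply]
        exact not_le.1 hle)
    rw [hF.expAct e hG] at hη'
    -- The real factor exp(α) stays inside the orbit, so the shortened pair is an admissible
    -- competitor.
    have h3 : (η', expAct e α y) ∈ S := by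
      refine ⟨⟨hlt.le.trans hηle, ?_⟩, hη'⟩
      obtain ⟨u, rfl⟩ := hy
      exact ⟨expG (e α) * u, mul_smul _ _ _⟩
    exact (isMinOn_iff.1 hmin _ h3).not_gt hlt

end Uniqueness

end NessUniqueness

theorem theorem6p3 {n : ℕ} (G : ClosedSubgroup (Matrix.unitaryGroup (Fin n) ℂ))
    {E : Type*} [NormedAddCommGroup E] [NormedSpace ℂ E] [FiniteDimensional ℂ E]
    {X : Type*} [TopologicalSpace X] [T2Space X] [CompactSpace X]
    [ChartedSpace E X] [IsManifold 𝓘(ℂ, E) ω X] (Ω : NessUniqueness.KaehlerForm E X)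
    [MulAction G X] (hG : NessUniqueness.IsKaehlerAction G Ω)
    (B : NessUniqueness.InvariantInner G) (μ : X → NessUniqueness.lieAlg G)
    (hμ : NessUniqueness.IsMomentMap Ω B μ)
    (x₀ x₁ : X) (h₀ : NessUniqueness.IsCritical E B μ x₀)
    (h₁ : NessUniqueness.IsCritical E B μ x₁)
    (h : x₁ ∈ NessUniqueness.complexOrbit E G x₀) :
    x₁ ∈ MulAction.orbit G x₀ := by
  have : IsManifold 𝓘(ℝ, E) ∞ X := NessUniqueness.isManifold_real
  have : FiniteDimensional ℝ E := FiniteDimensional.complexToReal E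
  have : CompleteSpace E := FiniteDimensional.complete ℝ E
  have : Module.Finite ℝ (Matrix (Fin n) (Fin n) ℂ) := Module.Finite.matrix
  let e := (Module.finBasis ℝ (NessUniqueness.lieAlg G)).equivFun.symm
  have hV := NessUniqueness.contDiffOn_localField_cplxInfAct (X := X) (Ω := Ω) e hG
  obtain ⟨F, hF⟩ := NessUniqueness.exists_isFlow hV
  obtain ⟨g, -, u, ξ, -, γ, hγ, hγ0, hγ1⟩ := h
  refine NessUniqueness.mem_orbit_of_flow e hG hμ hF
    (hμ.infAction_eq_zero_of_isCritical e h₀) (hμ.infAction_eq_zero_of_isCritical e h₁)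
    (u₀ := u) (η₀ := e.symm ξ) ?_
  rw [← hγ0, ← hγ1]
  -- By uniqueness, the integral curve in the definition of the complex orbit is the flow line of
  -- the parameter (0, η₀).
  refine congrFun (hF.eq_of_hasVelocity hV fun t => ?_) 1
  rw [NessUniqueness.cplxInfAct_snd e hG, LinearEquiv.apply_symm_apply]
  exact NessUniqueness.hasVelocity_iff_hasMFDerivAt.2 (hγ t)
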